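/- Theorem 1.7. Fix $k\ge 0$ and a reduced word $\Delta=\sigma_{a_1}\cdots\sigma_{a_\ell}$, $\ell=\ell(w_0)$, for the longest element $w_0\in S_k$. A positive braid on $k$ strands is given by a word $\beta=\sigma_{i_1}\cdots\sigma_{i_r}$ in the generators $\sigma_1,\dots,\sigma_{k-1}$. *Flags.* For $M\in \mathrm{GL}_k(\mathbb C)$ let $\mathcal F(M)$ be the complete flag in $\mathbb C^k$ whose $i$-th space is spanned by the first $i$ columns of $M$; identify $w\in S_k$ with its permutation matrix $e_j\mapsto e_{w(j)}$, and put $\mathcal F^{\rm std}=\mathcal F(e)$, $\mathcal F^{\rm ant}=\mathcal F(w_0)$. Flags $\mathcal F,\mathcal F'$ are in relative position $w$ if $g\mathcal F=\mathcal F^{\rm std}$ and $g\mathcal F'=\mathcal F(w)$ for some $g\in\mathrm{GL}_k(\mathbb C)$, and transverse, $\mathcal F\pitchfork\mathcal F'$, if they are in relative position $w_0$. A chain along $\beta$ is a tuple of flags $(\mathcal F^0,\dots,\mathcal F^r)$ with $\mathcal F^{j-1},\mathcal F^j$ in relative position $s_{i_j}$ for all $j$. Let $X(\beta)$ (braid variety)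 be the set of chains along $\beta$ with $\mathcal F^0=\mathcal F^{\rm std}$, $\mathcal F^r=\mathcal F^{\rm ant}$, and $\mathrm{BS}(\beta)$ (double Bott–Samelson variety) the set of chains along $\beta$ with $\mathcal F^0=\mathcal F^{\rm std}$, $\mathcal F^r\pitchfork\mathcal F^{\rm ant}$. *Coordinates.* Let $B_i(z)$ be the identity matrix with the block in rows and columns $i,i+1$ replaced by $\begin{pmatrix} z&-1\\1&0\end{pmatrix}$, and $B_\beta(z_1,\dots,z_r)=B_{i_1}(z_1)\cdots B_{i_r}(z_r)$. Every chain along $\beta$ starting at $\mathcal F^{\rm std}$ has unique coordinates $z\in\mathbb C^r$ with $\mathcal F^j=\mathcal F(B_{i_1}(z_1)\cdots B_{i_j}(z_j))$. *The maps $\varphi_1,\varphi_2$.* For $(\mathcal F^0,\dots,\mathcal F^r)\in\mathrm{BS}(\beta)$, $\varphi_1(\mathcal F^0,\dots,\mathcal F^r)\in X(\beta\Delta)$ is obtained by appending the unique chain along $\Delta$ from $\mathcal F^r$ to $\mathcal F^{\rm ant}$. Write $\mathcal F^r=\mathcal F(w_0V_1w_0V_2)$ with $V_1,V_2$ upper triangular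 and $V_1$ with $1$'s on the diagonal; then $\varphi_2(\mathcal F^0,\dots,\mathcal F^r)\in X(\Delta\beta)$ is $(V_1^{-1}w_0\mathcal F^0,\dots,V_1^{-1}w_0\mathcal F^r)$ preceded by the unique chain along $\Delta$ from $\mathcal F^{\rm std}$ to $V_1^{-1}w_0\mathcal F^0$. *Braid variety splicing.* For $w\in S_k$ and $0\le r_1\le r$ let $\mathcal U_{r_1,w}\subseteq X(\beta)$ be the locus $\mathcal F^{r_1}\pitchfork\mathcal F(w_0w)$. Choose a reduced word $a_1\cdots a_\ell$ for $w_0$ whose prefix $\underline w$ of length $\ell(w)$ is a reduced word for $w$; write $\underline{w^{-1}w_0}$ for the remaining suffix, and let $\mathcal F^{\rm ant}=\widetilde{\mathcal F}^0,\widetilde{\mathcal F}^1,\dots,\widetilde{\mathcal F}^{\ell}=\mathcal F^{\rm std}$ be the unique chain along this word. On $\mathcal U_{r_1,w}$ write $\mathcal F^{r_1}=\mathcal F((w_0ww_0)LU)$ with $U$ upper triangular and $L$ lower triangular with $1$'s on the diagonal, and put $g_2=((w_0ww_0)L)^{-1}$, $g_1=w_0g_2$. With $\beta^1=\sigma_{i_1}\cdots\sigma_{i_{r_1}}$,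 $\beta^2=\sigma_{i_{r_1+1}}\cdots\sigma_{i_r}$, $$\Phi_{r_1,w}(\mathcal F^0,\dots,\mathcal F^r)=\Bigl(g_1(\widetilde{\mathcal F}^{\ell(w)},\dots,\widetilde{\mathcal F}^{\ell},\mathcal F^1,\dots,\mathcal F^{r_1}),\ g_2(\mathcal F^{r_1},\dots,\mathcal F^r,\widetilde{\mathcal F}^1,\dots,\widetilde{\mathcal F}^{\ell(w)})\Bigr)\in X(\underline{w^{-1}w_0}\,\beta^1)\times X(\beta^2\underline w).$$ Below, the reduced word used is $\Delta$, both for $w=e$ and for $w=w_0$. *Double Bott–Samelson splicing.* Let $\beta=\beta^1\beta^2$ with $\beta^1$ of length $r_1$. Let $\mathcal U_{r_1}\subseteq\mathrm{BS}(\beta)$ be the locus where, for every letter $\sigma_s$ occurring in $\beta^1$, with last occurrence in position $j\le r_1$, the upper left $s\times s$ minor of $B_{i_1}(z_1)\cdots B_{i_j}(z_j)$ is nonzero. On $\mathcal U_{r_1}$ there is a unique factorization $B_{\beta^1}(z_1,\dots,z_{r_1})=L_1U_1$ with $L_1$ lower triangular with $1$'s on the diagonal and $U_1$ upper triangular, and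 in coordinates $\Phi_{r_1}(z_1,\dots,z_r)=((z_1,\dots,z_{r_1}),(z'_{r_1+1},\dots,z'_r))\in\mathrm{BS}(\beta^1)\times\mathrm{BS}(\beta^2)$, where $z'$ is obtained by sliding $U_1$ through $B_{\beta^2}$ letter by letter: $U^{(j)}B_{i_j}(z_j)=B_{i_j}(z'_j)U^{(j+1)}$ for $j=r_1+1,\dots,r$, with all $U^{(j)}$ upper triangular and $U^{(r_1+1)}=U_1$. **Theorem.** For every $\beta$ the maps $\varphi_1:\mathrm{BS}(\beta)\to X(\beta\Delta)$ and $\varphi_2:\mathrm{BS}(\beta)\to X(\Delta\beta)$ are well defined and bijective. For $\beta=\beta^1\beta^2$ with $\beta^1$ of length $r_1\geq 0$, $\Phi_{r_1}$ maps $\mathcal U_{r_1}$ into $\mathrm{BS}(\beta^1)\times\mathrm{BS}(\beta^2)$; $\varphi_1$ restricts to a bijection from $\mathcal U_{r_1}$ to $\mathcal U_{r_1,e}\subseteq X(\beta\Delta)$, and $\varphi_2$ to a bijection from $\mathcal U_{r_1}$ to $\mathcal U_{r_1+\ell(w_0),w_0}\subseteq X(\Delta\beta)$; both $\Phi_{r_1,e}$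 and $\Phi_{r_1+\ell(w_0),w_0}$ take values on these sets in $X(\Delta\beta^1)\times X(\beta^2\Delta)$; and on $\mathcal U_{r_1}$ $$(\varphi_2\times\varphi_1)\circ\Phi_{r_1}=\Phi_{r_1,e}\circ\varphi_1,\qquad (\varphi_2\times\varphi_1)\circ\Phi_{r_1}=\Phi_{r_1+\ell(w_0),w_0}\circ\varphi_2 .$$ -/

import Mathlib

open scoped MatrixGroups

namespace Splicing

noncomputable section

/-- The object characterised by `p`, when there is exactly one such object. -/
def theUnique {α : Type*} [Inhabited α] (p : α → Prop) : α :=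
  open scoped Classical in if h : ∃! x, p x then h.choose else default

/-! ### Complete flags in `ℂ^k` -/

/-- A complete flag `0 = F_0 ⊆ F_1 ⊆ ⋯ ⊆ F_k = ℂ^k` with `dim F_i = i`. -/
@[ext]
structure CompleteFlag (k : ℕ) where
  space : Fin (k + 1) → Submodule ℂ (Fin k → ℂ)
  mono : Monotone space
  finrank_space : ∀ i, Module.finrank ℂ (space i) = i

/-- The flag whose `i`-th space is spanned by the first `i` of the vectors `v`. -/
def spanFlag {k : ℕ} (v : Fin k → Fin k → ℂ) (hv : LinearIndependent ℂ v) : CompleteFlag k where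
  space i := Submodule.span ℂ (v '' {j | (j : ℕ) < i})
  mono i i' h := Submodule.span_mono (Set.image_mono fun j (hj : (j : ℕ) < i) =>
    lt_of_lt_of_le hj h)
  finrank_space i := by
    have h1 : LinearIndependent ℂ (fun j : {j : Fin k | (j : ℕ) < i} => v j) :=
      hv.comp _ Subtype.val_injective
    have h2 := finrank_span_eq_card h1
    have h3 : Set.range (fun j : {j : Fin k | (j : ℕ) < i} => v j)
        = v '' {j | (j : ℕ) < i} := by
      ext x; simp
    rw [h3] at h2
    rw [h2]
    have h5 : Fintype.card (Fin (i : ℕ)) = Fintype.card {j : Fin k | (j : ℕ) < i} :=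
      Fintype.card_congr
        { toFun := fun a => ⟨⟨a, lt_of_lt_of_le a.2 (Nat.lt_succ_iff.mp i.2)⟩, a.2⟩
          invFun := fun b => ⟨b.1, b.2⟩
          left_inv := fun _ => rfl
          right_inv := fun _ => rfl }
    rw [← h5, Fintype.card_fin]

/-- The flag `𝓕(M)` of an invertible matrix: its `i`-th space is spanned by the first `i`
columns of `M`. -/
def ofMatrix {k : ℕ} (M : GL (Fin k) ℂ) : CompleteFlag k :=
  spanFlag (fun j => M.val.col j) (Matrix.linearIndependent_cols_iff_isUnit.mpr M.isUnit)

/-- The coordinate flag `𝓕(w)`, with `i`-th space spanned by `e_{w(1)}, …, e_{w(i)}`. -/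
def coordFlag {k : ℕ} (w : Equiv.Perm (Fin k)) : CompleteFlag k :=
  spanFlag (fun j => Pi.single (w j) 1)
    ((Pi.linearIndependent_single_one (Fin k) ℂ).comp w w.injective)

/-- `GL(k)` acts on flags by moving every space of the flag. -/
instance {k : ℕ} : SMul (GL (Fin k) ℂ) (CompleteFlag k) where
  smul g F :=
    { space := fun i => (F.space i).map (Matrix.mulVecLin g.val)
      mono := fun _ _ h => Submodule.map_mono (F.mono h)
      finrank_space := fun i =>
        ((Submodule.equivMapOfInjective _ (Matrix.mulVec_injective_iff_isUnit.mpr g.isUnit)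
          (F.space i)).finrank_eq).symm.trans (F.finrank_space i) }

/-- The longest element `w₀`, that is `j ↦ k + 1 - j`. -/
def longest (k : ℕ) : Equiv.Perm (Fin k) := Fin.revPerm

/-- The standard flag. -/
def stdFlag (k : ℕ) : CompleteFlag k := coordFlag 1

/-- The antistandard flag. -/
def antFlag (k : ℕ) : CompleteFlag k := coordFlag (longest k)

/-- The permutation matrix of `w`, sending `e_j` to `e_{w(j)}`. -/
def permGL {k : ℕ} (w : Equiv.Perm (Fin k)) : GL (Fin k) ℂ where
  val := Matrix.of fun a b => if a = w b then 1 else 0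
  inv := Matrix.of fun a b => if a = w⁻¹ b then 1 else 0
  val_inv := by
    ext a b
    simp [Matrix.mul_apply, Matrix.one_apply]
  inv_val := by
    ext a b
    simp [Matrix.mul_apply, Matrix.one_apply]

/-! ### Words, relative position, and chains of flags

A positive braid on `k` strands is given by a word in the generators. The letters are indexed by
`Fin (k - 1)`, starting from `0`: the letter `i` is the generator usually called `σ_{i+1}`. -/

/-- The first of the two strands crossed by the letter `i`. -/
def lo {k : ℕ} (i : Fin (k - 1)) : Fin k := ⟨i, by omega⟩

/-- The second of the two strands crossed by the letter `i`. -/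
def hi {k : ℕ} (i : Fin (k - 1)) : Fin k := ⟨i + 1, by omega⟩

/-- The simple transposition of the letter `i`. -/
def simple {k : ℕ} (i : Fin (k - 1)) : Equiv.Perm (Fin k) := Equiv.swap (lo i) (hi i)

/-- `a` is a reduced word for `w`: its product is `w`, and no shorter word has product `w`. -/
def IsReducedWord {k : ℕ} (w : Equiv.Perm (Fin k)) (a : List (Fin (k - 1))) : Prop :=
  (a.map simple).prod = w ∧
    ∀ b : List (Fin (k - 1)), (b.map simple).prod = w → a.length ≤ b.length

/-- `F` and `F'` are in relative position `w`. -/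
def RelPos {k : ℕ} (w : Equiv.Perm (Fin k)) (F F' : CompleteFlag k) : Prop :=
  ∃ g : GL (Fin k) ℂ, g • F = stdFlag k ∧ g • F' = coordFlag w

/-- `F` and `F'` are transverse: they are in relative position `w₀`. -/
def Transverse {k : ℕ} (F F' : CompleteFlag k) : Prop := RelPos (longest k) F F'

/-- `IsChain β [F₀, …, F_r]`: for the word `β = i₁ ⋯ i_r`, the flags `F_{j-1}` and `F_j` are in
relative position `s_{i_j}` for `j = 1, …, r`. -/
inductive IsChain {k : ℕ} : List (Fin (k - 1)) → List (CompleteFlag k) → Prop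
  | single (F : CompleteFlag k) : IsChain [] [F]
  | cons (i : Fin (k - 1)) (β : List (Fin (k - 1))) (F F' : CompleteFlag k)
      (Fs : List (CompleteFlag k)) :
      RelPos (simple i) F F' → IsChain β (F' :: Fs) → IsChain (i :: β) (F :: F' :: Fs)

/-- The braid variety `X(β)`. -/
def braidVariety {k : ℕ} (β : List (Fin (k - 1))) : Set (List (CompleteFlag k)) :=
  {Fs | IsChain β Fs ∧ Fs.head? = some (stdFlag k) ∧ Fs.getLast? = some (antFlag k)}

/-- The double Bott--Samelson variety `BS(β)`. -/
def bottSamelson {k : ℕ} (β : List (Fin (k - 1))) : Set (List (CompleteFlag k)) :=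
  {Fs | IsChain β Fs ∧ Fs.head? = some (stdFlag k) ∧
    ∃ F, Fs.getLast? = some F ∧ Transverse F (antFlag k)}

/-- The unique chain spelling the word `a` from the flag `F` to the flag `F'`
(both ends included). -/
def path {k : ℕ} (a : List (Fin (k - 1))) (F F' : CompleteFlag k) : List (CompleteFlag k) :=
  theUnique fun Fs => IsChain a Fs ∧ Fs.head? = some F ∧ Fs.getLast? = some F'

/-- A matrix acting on a chain of flags: `g(F₀, …, F_r) = (gF₀, …, gF_r)`. -/
def translate {k : ℕ} (g : GL (Fin k) ℂ) (Fs : List (CompleteFlag k)) : List (CompleteFlag k) :=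
  Fs.map fun F => g • F

/-- Upper-triangular matrices. -/
def IsUpper {k : ℕ} (M : Matrix (Fin k) (Fin k) ℂ) : Prop := ∀ a b, b < a → M a b = 0

/-- Lower-triangular matrices. -/
def IsLower {k : ℕ} (M : Matrix (Fin k) (Fin k) ℂ) : Prop := ∀ a b, a < b → M a b = 0

/-- Matrices with `1`'s on the diagonal. -/
def IsUnidiagonal {k : ℕ} (M : Matrix (Fin k) (Fin k) ℂ) : Prop := ∀ a, M a a = 1

/-! ### From double Bott--Samelson varieties to braid varieties

`Δ` is a reduced word for `w₀`. -/

/-- `φ₁(F₀, …, F_r) = (F₀, …, F_r, F_{r+1}, …, 𝓕(w₀))`, where the new flags continue the chain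
from `F_r` to the antistandard flag along `Δ`. -/
def phi₁ {k : ℕ} (Δ : List (Fin (k - 1))) (Fs : List (CompleteFlag k)) :
    List (CompleteFlag k) :=
  Fs ++ (path Δ (Fs.getLastD (stdFlag k)) (antFlag k)).tail

/-- For a flag `F` transverse to the antistandard one, the unique upper-triangular `V₁` with `1`'s
on the diagonal such that `F = 𝓕((w₀ V₁ w₀) V₂)` for some upper-triangular `V₂`. -/
def upperPart {k : ℕ} (F : CompleteFlag k) : GL (Fin k) ℂ :=
  theUnique fun V₁ => IsUpper V₁.val ∧ IsUnidiagonal V₁.val ∧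
    ∃ V₂ : GL (Fin k) ℂ, IsUpper V₂.val ∧
      F = ofMatrix ((permGL (longest k) * V₁ * permGL (longest k)) * V₂)

/-- `φ₂(F₀, …, F_r) = (F^std, F̃₁, …, F̃_{ℓ(w₀)-1}, V₁⁻¹w₀F₀, …, V₁⁻¹w₀F_r)`, where
`F_r = 𝓕((w₀ V₁ w₀) V₂)` and the flags before `V₁⁻¹w₀F₀` form the chain along `Δ` from the
standard flag to `V₁⁻¹w₀F₀`. -/
def phi₂ {k : ℕ} (Δ : List (Fin (k - 1))) (Fs : List (CompleteFlag k)) :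
    List (CompleteFlag k) :=
  let g := (upperPart (Fs.getLastD (stdFlag k)))⁻¹ * permGL (longest k)
  (path Δ (stdFlag k) (g • Fs.headD (stdFlag k))).dropLast ++ translate g Fs

/-! ### Splicing of braid varieties -/

/-- The open set `𝓤_{r₁,w}(β)` in `X(β)` where `F_{r₁}` is transverse to `𝓕(w₀w)`. -/
def braidOpen {k : ℕ} (r₁ : ℕ) (w : Equiv.Perm (Fin k)) (β : List (Fin (k - 1))) :
    Set (List (CompleteFlag k)) :=
  {Fs | Fs ∈ braidVariety β ∧
    ∃ F, Fs[r₁]? = some F ∧ Transverse F (coordFlag (longest k * w))}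

/-- For a flag `F = 𝓕(M)` transverse to `𝓕(w₀w)`, the unique lower-triangular `L` with `1`'s on the
diagonal such that `M = (w₀ww₀)LU` with `U` upper-triangular. -/
def lowerPart {k : ℕ} (w : Equiv.Perm (Fin k)) (F : CompleteFlag k) : GL (Fin k) ℂ :=
  theUnique fun L => IsLower L.val ∧ IsUnidiagonal L.val ∧
    ∃ U : GL (Fin k) ℂ, IsUpper U.val ∧
      F = ofMatrix (permGL (longest k * w * longest k) * L * U)

/-- The splicing map `Φ_{r₁,w} = (Φ¹, Φ²)` on `𝓤_{r₁,w}(β)`, computed with the reduced word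
`a ++ a'` for `w₀` whose prefix `a` is a reduced word for `w`. With
`(F̃₀ = F^ant, F̃₁, …, F̃_{ℓ(w₀)} = F^std)` the chain spelled by `a ++ a'`, it is
`Φ¹ = g₁(F̃_{ℓ(w)}, …, F̃_{ℓ(w₀)} = F^std, F₁, …, F_{r₁})` and
`Φ² = g₂(F_{r₁}, …, F_r, F̃₁, …, F̃_{ℓ(w)})`, where `g₂ = ((w₀ww₀)L)⁻¹` and
`g₁ = w₀((w₀ww₀)L)⁻¹`. -/
def braidSplice {k : ℕ} (r₁ : ℕ) (w : Equiv.Perm (Fin k)) (a a' : List (Fin (k - 1)))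
    (Fs : List (CompleteFlag k)) : List (CompleteFlag k) × List (CompleteFlag k) :=
  let L := lowerPart w (Fs.getD r₁ (stdFlag k))
  let g₂ := (permGL (longest k * w * longest k) * L)⁻¹
  let g₁ := permGL (longest k) * (permGL (longest k * w * longest k) * L)⁻¹
  let bottom := path (a ++ a') (antFlag k) (stdFlag k)
  (translate g₁ (bottom.drop a.length ++ (Fs.take (r₁ + 1)).tail),
    translate g₂ (Fs.drop r₁ ++ (bottom.take (a.length + 1)).tail))

/-! ### Braid matrices and splicing of double Bott--Samelson varieties -/

/-- The braid matrix `B_i(z)`, row by row: row `i` is `z e_i - e_{i+1}`, row `i + 1` is `e_i`, and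
every other row is that of the identity matrix. -/
def braidMatrix {k : ℕ} (i : Fin (k - 1)) (z : ℂ) : Matrix (Fin k) (Fin k) ℂ :=
  Matrix.of fun a =>
    if a = lo i then Pi.single (lo i) z - Pi.single (hi i) 1
    else if a = hi i then Pi.single (lo i) 1
    else Pi.single a 1

theorem isUnit_braidMatrix {k : ℕ} (i : Fin (k - 1)) (z : ℂ) : IsUnit (braidMatrix i z) := by
  have hne : lo i ≠ hi i := by simp [lo, hi]
  rw [← Matrix.mulVec_injective_iff_isUnit]
  intro v v' h
  have h1 := congrFun h (hi i)
  have h2 := congrFun h (lo i)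
  simp [braidMatrix, Matrix.mulVec, hne.symm] at h1
  have h4 : ∀ u, (braidMatrix i z).mulVec u (lo i) = z * u (lo i) - u (hi i) := fun u => by
    have h5 : (braidMatrix i z).mulVec u (lo i)
        = (Pi.single (lo i) z - Pi.single (hi i) 1) ⬝ᵥ u := by
      simp only [braidMatrix, Matrix.mulVec, Matrix.of_apply, if_true]
    rw [h5, sub_dotProduct]
    simp
  rw [h4, h4, h1] at h2
  replace h2 := sub_right_injective h2
  ext a
  by_cases ha : a = lo i
  · rw [ha, h1]
  by_cases hb : a = hi i
  · rw [hb, h2]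
  have h3 := congrFun h a
  simpa [braidMatrix, Matrix.mulVec, ha, hb] using h3

/-- The braid matrix as an element of `GL(k)`. -/
def braidGL {k : ℕ} (i : Fin (k - 1)) (z : ℂ) : GL (Fin k) ℂ := (isUnit_braidMatrix i z).unit

/-- `B_β(z₁, …, z_r) = B_{i₁}(z₁) ⋯ B_{i_r}(z_r)`. -/
def braidProd {k : ℕ} (β : List (Fin (k - 1))) (z : List ℂ) : GL (Fin k) ℂ :=
  (List.zipWith braidGL β z).prod

/-- The chain of flags with coordinates `z`:
`𝓕(1), 𝓕(B_{i₁}(z₁)), 𝓕(B_{i₁}(z₁)B_{i₂}(z₂)), …`. -/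
def chart {k : ℕ} (β : List (Fin (k - 1))) (z : List ℂ) : List (CompleteFlag k) :=
  ((List.zipWith braidGL β z).scanl (· * ·) 1).map ofMatrix

/-- The coordinates `z₁, …, z_r` of a chain of flags along `β` that starts at the standard flag. -/
def coords {k : ℕ} (β : List (Fin (k - 1))) (Fs : List (CompleteFlag k)) : List ℂ :=
  theUnique fun z => z.length = β.length ∧ chart β z = Fs

/-- The principal minor of `M` on the first `m` rows and columns. -/
def principalMinor {k : ℕ} (m : ℕ) (hm : m ≤ k) (M : Matrix (Fin k) (Fin k) ℂ) : ℂ :=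
  (M.submatrix (Fin.castLE hm) (Fin.castLE hm)).det

/-- The open set `𝓤_{r₁}(β)` in `BS(β)`, for `β = β₁β₂` and `r₁` the length of `β₁`: for every
letter `s` that occurs in `β₁`, at position `j` for the last time, the cluster variable
`x_j = Δ_{[s],[s]}(B_{i₁}(z₁) ⋯ B_{i_j}(z_j))` does not vanish. -/
def bottSamelsonOpen {k : ℕ} (β₁ β₂ : List (Fin (k - 1))) : Set (List (CompleteFlag k)) :=
  {Fs | Fs ∈ bottSamelson (β₁ ++ β₂) ∧
    ∀ (s : Fin (k - 1)) (γ δ : List (Fin (k - 1))), β₁ = γ ++ s :: δ → s ∉ δ →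
      principalMinor (s + 1) (by omega)
        (braidProd (γ ++ [s]) ((coords (β₁ ++ β₂) Fs).take (γ.length + 1))).val ≠ 0}

/-- The unique factorisation `M = LU` with `L` lower-triangular with `1`'s on the diagonal and `U`
upper-triangular. -/
def luFactors {k : ℕ} (M : Matrix (Fin k) (Fin k) ℂ) :
    Matrix (Fin k) (Fin k) ℂ × Matrix (Fin k) (Fin k) ℂ :=
  theUnique fun LU => IsLower LU.1 ∧ IsUnidiagonal LU.1 ∧ IsUpper LU.2 ∧ M = LU.1 * LU.2

/-- Sliding an upper-triangular matrix through a braid word: the coordinates `z'` with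
`U B_{i₁}(z₁) ⋯ B_{i_r}(z_r) = B_{i₁}(z'₁) ⋯ B_{i_r}(z'_r) U'` obtained letter by letter, where
`U B_i(z) = B_i(z') U''` with `U''` upper-triangular forces
`z' = (U_{i,i} z + U_{i,i+1}) / U_{i+1,i+1}`. -/
def slide {k : ℕ} : Matrix (Fin k) (Fin k) ℂ → List (Fin (k - 1)) → List ℂ → List ℂ
  | U, i :: β, z :: zs =>
    let z' := (U (lo i) (lo i) * z + U (lo i) (hi i)) / U (hi i) (hi i)
    z' :: slide ((braidMatrix i z')⁻¹ * U * braidMatrix i z) β zs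
  | _, _, _ => []

/-- The splicing map `Φ_{r₁}` on `𝓤_{r₁}(β)`, for `β = β₁β₂` and `r₁` the length of `β₁`. In
coordinates, `(z₁, …, z_r) ↦ ((z₁, …, z_{r₁}), (z'_{r₁+1}, …, z'_r))`, where
`B_{β₁}(z₁, …, z_{r₁}) = L₁U₁` and `z'` is obtained by sliding `U₁` through
`B_{β₂}(z_{r₁+1}, …, z_r)`. -/
def bottSamelsonSplice {k : ℕ} (β₁ β₂ : List (Fin (k - 1))) (Fs : List (CompleteFlag k)) :
    List (CompleteFlag k) × List (CompleteFlag k) :=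
  let z := coords (β₁ ++ β₂) Fs
  let zL := z.take β₁.length
  let zR := z.drop β₁.length
  let U₁ := (luFactors (braidProd β₁ zL).val).2
  (chart β₁ zL, chart β₂ (slide U₁ β₂ zR))

end

end Splicing

open Splicing

namespace Splicing

variable {k : ℕ}

/-! ### The action of `GL(k)` on complete flags -/

/-! Everything is moved from matrices to flags. Upper (lower) triangular matrices are the stabiliser
of the standard (antistandard) flag, so a flag transverse to `antFlag` is `L • stdFlag k` for a
unique unipotent lower-triangular `L` (`transverse_antFlag_iff`, `IsUnipotentLower.eq_of_smul_std`).
Every normalisation in the definitions reads off this `L`: `upperPart`, `lowerPart` and the lower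
factor in `luFactors`.

For a reduced word of `w`, flags joined by a chain along it are in relative position `w`, and two
flags in that position are joined by exactly one chain (`IsChainBetween.relPos`,
`RelPos.existsUnique_chain`). Hence `φ₁` is inverted by cutting off the last part of a chain. If the
last flag is `L • stdFlag k`, then `φ₂` translates by `w₀L⁻¹`, which sends the last flag to the
antistandard one and the antistandard flag to the standard one. The flag where the prefix `Δ` ends
is `w₀L⁻¹ • stdFlag k`; it determines `L`, so `φ₂` is inverted too.

A letter `s` changes only one space of the flag, so the minor at its last occurrence in `β₁` tests
that space of the flag at position `r₁`. Together the minors say that this flag is transverse to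
`antFlag` (`transverse_iff_principalMinor`), which identifies the open sets.

For the squares, let the chain consist of `A` ending at `L • stdFlag k` and `B` ending at `M •
stdFlag k`. Sliding `U₁` through a word is translation of flags by `U₁` (`slide_spec`), so `Φ_{r₁}`
gives `(A, L⁻¹B)`. All composites then equal the same pair: the `Δ`-path to `w₀L⁻¹ • stdFlag k`
followed by `w₀L⁻¹A`, and `L⁻¹B` followed by the `Δ`-path to `antFlag`. For `w = w₀` this rests on
`(w₀M⁻¹L)⁻¹(w₀M⁻¹) = L⁻¹`. -/

theorem smul_space (g : GL (Fin k) ℂ) (F : CompleteFlag k) (i : Fin (k + 1)) :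
    (g • F).space i = (F.space i).map (Matrix.mulVecLin g.val) := rfl

instance : MulAction (GL (Fin k) ℂ) (CompleteFlag k) where
  one_smul F := by
    ext1; funext i
    simp [smul_space]
  mul_smul g h F := by
    ext1; funext i
    simp [smul_space, Matrix.mulVecLin_mul, Submodule.map_comp]

theorem GL_mulVec_inv_mulVec (g : GL (Fin k) ℂ) (x : Fin k → ℂ) :
    g.val.mulVec ((g⁻¹).val.mulVec x) = x := by
  rw [Matrix.mulVec_mulVec, ← Units.val_mul, mul_inv_cancel]; simp

theorem GL_inv_mulVec_mulVec (g : GL (Fin k) ℂ) (x : Fin k → ℂ) :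
    (g⁻¹).val.mulVec (g.val.mulVec x) = x := by
  rw [Matrix.mulVec_mulVec, ← Units.val_mul, inv_mul_cancel]; simp

theorem mulVec_mem_smul {g : GL (Fin k) ℂ} {F : CompleteFlag k} {i : Fin (k + 1)}
    {x : Fin k → ℂ} (hx : x ∈ F.space i) : g.val.mulVec x ∈ (g • F).space i :=
  ⟨x, hx, rfl⟩

theorem mem_smul_space {g : GL (Fin k) ℂ} {F : CompleteFlag k} {i : Fin (k + 1)}
    {x : Fin k → ℂ} : x ∈ (g • F).space i ↔ (g⁻¹).val.mulVec x ∈ F.space i := by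
  constructor
  · rintro ⟨y, hy, rfl⟩
    rw [Matrix.mulVecLin_apply, GL_inv_mulVec_mulVec]
    exact hy
  · intro h
    have := mulVec_mem_smul (g := g) h
    rwa [GL_mulVec_inv_mulVec] at this

theorem CompleteFlag.eq_of_le {F F' : CompleteFlag k} (h : ∀ i, F.space i ≤ F'.space i) :
    F = F' := by
  ext1; funext i
  exact Submodule.eq_of_le_of_finrank_eq (h i) (by rw [F.finrank_space, F'.finrank_space])

theorem CompleteFlag.space_zero (F : CompleteFlag k) {i : Fin (k + 1)} (hi : (i : ℕ) = 0) :
    F.space i = ⊥ := by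
  rw [← Submodule.finrank_eq_zero (R := ℂ), F.finrank_space, hi]

theorem CompleteFlag.space_last (F : CompleteFlag k) {i : Fin (k + 1)} (hi : (i : ℕ) = k) :
    F.space i = ⊤ := by
  apply Submodule.eq_top_of_finrank_eq
  rw [F.finrank_space, hi]; simp

/-! ### Coordinate flags -/

theorem mem_coordFlag {w : Equiv.Perm (Fin k)} {i : Fin (k + 1)} {x : Fin k → ℂ} :
    x ∈ (coordFlag w).space i ↔ ∀ a, (i : ℕ) ≤ (w⁻¹ a : Fin k) → x a = 0 := by
  constructor
  · intro hx a ha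
    have : (coordFlag w).space i ≤ LinearMap.ker (LinearMap.proj a : (Fin k → ℂ) →ₗ[ℂ] ℂ) := by
      refine Submodule.span_le.mpr ?_
      rintro _ ⟨j, hj, rfl⟩
      have hne : a ≠ w j := by
        rintro rfl
        simp at ha hj
        omega
      simp [hne]
    exact this hx
  · intro h
    have hx : x = ∑ a, x a • (Pi.single a (1 : ℂ) : Fin k → ℂ) := by
      ext b
      simp [Finset.sum_apply, Pi.single_apply]
    rw [hx]
    refine Submodule.sum_mem _ fun a _ => ?_
    by_cases ha : (i : ℕ) ≤ (w⁻¹ a : Fin k)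
    · simp [h a ha]
    · refine Submodule.smul_mem _ _ (Submodule.subset_span ⟨w⁻¹ a, ?_, ?_⟩)
      · simpa using ha
      · simp

theorem mem_stdFlag {i : Fin (k + 1)} {x : Fin k → ℂ} :
    x ∈ (stdFlag k).space i ↔ ∀ a : Fin k, (i : ℕ) ≤ a → x a = 0 := by
  simp [stdFlag, mem_coordFlag]

theorem mem_antFlag {i : Fin (k + 1)} {x : Fin k → ℂ} :
    x ∈ (antFlag k).space i ↔ ∀ a : Fin k, (a : ℕ) + i < k → x a = 0 := by
  rw [antFlag, mem_coordFlag]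
  refine forall_congr' fun a => ?_
  have : ((longest k)⁻¹ a : Fin k).val = k - (a + 1) := by
    simp [longest, Fin.revPerm, Fin.val_rev]
  rw [this]
  have := a.2
  constructor <;> intro h h' <;> exact h (by omega)

theorem single_mem_coordFlag {w : Equiv.Perm (Fin k)} {i : Fin (k + 1)} {a : Fin k} (c : ℂ)
    (h : (w⁻¹ a : Fin k).val < i) : Pi.single a c ∈ (coordFlag w).space i := by
  rw [mem_coordFlag]
  intro b hb
  have : b ≠ a := by rintro rfl; omega
  simp [this]

theorem permGL_smul_coordFlag (v w : Equiv.Perm (Fin k)) :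
    permGL v • coordFlag w = coordFlag (v * w) := by
  apply CompleteFlag.eq_of_le
  intro i x hx
  rw [mem_smul_space, mem_coordFlag] at hx
  rw [mem_coordFlag]
  intro a ha
  have h1 := hx (v⁻¹ a) (by simpa using ha)
  have h2 : ((permGL v)⁻¹).val.mulVec x (v⁻¹ a) = x a := by
    change (Matrix.of fun a b => if a = v⁻¹ b then (1:ℂ) else 0).mulVec x (v⁻¹ a) = x a
    simp [Matrix.mulVec, dotProduct]
  rw [← h2, h1]

theorem longest_mul_longest : longest k * longest k = 1 := by
  ext a; simp [longest]

theorem permGL_mul (v w : Equiv.Perm (Fin k)) : permGL (v * w) = permGL v * permGL w := by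
  ext a b
  simp only [permGL, Units.val_mul, Matrix.mul_apply, Matrix.of_apply]
  by_cases h : a = v (w b) <;> simp [h]

theorem permGL_one : permGL (1 : Equiv.Perm (Fin k)) = 1 := by
  ext a b
  by_cases h : a = b <;> simp [permGL, h]

theorem permGL_longest_mul_self : permGL (longest k) * permGL (longest k) = 1 := by
  rw [← permGL_mul, longest_mul_longest, permGL_one]

theorem permGL_longest_inv : (permGL (longest k))⁻¹ = permGL (longest k) :=
  inv_eq_of_mul_eq_one_left permGL_longest_mul_self

theorem permGL_longest_smul_std : permGL (longest k) • stdFlag k = antFlag k := by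
  rw [stdFlag, permGL_smul_coordFlag, mul_one]; rfl

theorem permGL_longest_smul_ant : permGL (longest k) • antFlag k = stdFlag k := by
  rw [antFlag, permGL_smul_coordFlag, longest_mul_longest]; rfl

theorem permGL_longest_smul_smul (F : CompleteFlag k) :
    permGL (longest k) • permGL (longest k) • F = F := by
  rw [smul_smul, permGL_longest_mul_self, one_smul]

theorem ofMatrix_eq_smul (M : GL (Fin k) ℂ) : ofMatrix M = M • stdFlag k := by
  apply CompleteFlag.eq_of_le
  intro i
  refine Submodule.span_le.mpr ?_
  rintro _ ⟨j, hj, rfl⟩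
  have := mulVec_mem_smul (g := M) (single_mem_coordFlag (w := 1) (i := i) (a := j) 1 (by simpa using hj))
  rw [Matrix.mulVec_single_one] at this
  exact this

/-- A basis with `m`-th vector in the `(m+1)`-st space of a flag spans that flag. -/
theorem eq_smul_stdFlag {F : CompleteFlag k} {g : GL (Fin k) ℂ}
    (h : ∀ a : Fin k, g.val.col a ∈ F.space a.succ) : F = g • stdFlag k := by
  rw [← ofMatrix_eq_smul]
  refine (CompleteFlag.eq_of_le fun i => Submodule.span_le.mpr ?_).symm
  rintro _ ⟨j, hj, rfl⟩
  refine F.mono ?_ (h j)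
  rw [Fin.le_def]; simpa using hj

/-- Column `b` is the image of `e_b`, and it lies in the `(b+1)`-st standard space exactly when its
entries below the diagonal vanish. As a stabiliser condition, triangularity passes to inverses and
products without matrix computation. -/
theorem smul_stdFlag_eq_iff {g : GL (Fin k) ℂ} : g • stdFlag k = stdFlag k ↔ IsUpper g.val := by
  constructor
  · intro h a b hba
    have := mulVec_mem_smul (g := g) (single_mem_coordFlag (w := 1) (i := b.succ) (a := b) 1 (by simp))
    rw [Matrix.mulVec_single_one] at this
    change _ ∈ (g • stdFlag k).space _ at this
    rw [h, mem_stdFlag] at this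
    exact this a (by simpa [Nat.succ_le_iff] using hba)
  · intro h
    refine (eq_smul_stdFlag fun a => ?_).symm
    rw [mem_stdFlag]
    intro b hb
    exact h b a (by simpa [Nat.succ_le_iff] using hb)

/-- Conjugation by `w₀` rotates a matrix by a half turn, so it exchanges upper and lower triangular
matrices. -/
theorem permGL_longest_conj_apply (g : GL (Fin k) ℂ) (a b : Fin k) :
    (permGL (longest k) * g * permGL (longest k)).val a b = g.val a.rev b.rev := by
  have h1 : ∀ x y : Fin k, (x = y.rev) = (y = x.rev) := fun x y => by
    rw [← Fin.rev_eq_iff, eq_comm (a := y)]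
  simp only [Units.val_mul, permGL, Matrix.mul_apply, longest, Matrix.of_apply, Fin.revPerm_apply]
  simp only [h1 a, ite_mul, one_mul, zero_mul, mul_ite, mul_one, mul_zero]
  simp

theorem isUpper_conj {g : GL (Fin k) ℂ} :
    IsUpper (permGL (longest k) * g * permGL (longest k)).val ↔ IsLower g.val := by
  constructor
  · intro h a b hab
    have := h a.rev b.rev (by simpa using hab)
    rwa [permGL_longest_conj_apply, Fin.rev_rev, Fin.rev_rev] at this
  · intro h a b hab
    rw [permGL_longest_conj_apply]
    exact h _ _ (by simpa using hab)

theorem isUnidiagonal_conj {g : GL (Fin k) ℂ} :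
    IsUnidiagonal (permGL (longest k) * g * permGL (longest k)).val ↔ IsUnidiagonal g.val := by
  constructor
  · intro h a
    have := h a.rev
    rwa [permGL_longest_conj_apply, Fin.rev_rev] at this
  · intro h a
    rw [permGL_longest_conj_apply]
    exact h _

theorem smul_antFlag_eq_iff {g : GL (Fin k) ℂ} : g • antFlag k = antFlag k ↔ IsLower g.val := by
  rw [← isUpper_conj, ← smul_stdFlag_eq_iff, mul_smul, mul_smul, permGL_longest_smul_std]
  constructor
  · intro h; rw [h, permGL_longest_smul_ant]
  · intro h
    simpa [permGL_longest_smul_smul, permGL_longest_smul_std] using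
      congrArg (permGL (longest k) • ·) h

theorem CompleteFlag.exists_mem_succ_notMem (F : CompleteFlag k) (a : Fin k) :
    ∃ x ∈ F.space a.succ, x ∉ F.space a.castSucc := by
  by_contra! h
  have := Submodule.finrank_mono (show F.space a.succ ≤ F.space a.castSucc from h)
  rw [F.finrank_space, F.finrank_space] at this
  simp at this

theorem CompleteFlag.space_succ_eq_sup {F : CompleteFlag k} {a : Fin k} {x : Fin k → ℂ}
    (hx : x ∈ F.space a.succ) (hx' : x ∉ F.space a.castSucc) :
    F.space a.succ = F.space a.castSucc ⊔ Submodule.span ℂ {x} := by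
  symm
  apply Submodule.eq_of_le_of_finrank_le
  · exact sup_le (F.mono (Fin.castSucc_le_succ a)) (by simpa using hx)
  · have : F.space a.castSucc < F.space a.castSucc ⊔ Submodule.span ℂ {x} := by
      refine lt_of_le_of_ne le_sup_left fun h => hx' ?_
      rw [h]
      exact Submodule.mem_sup_right (Submodule.mem_span_singleton_self x)
    have := Submodule.finrank_lt_finrank_of_lt this
    rw [F.finrank_space] at this ⊢
    simpa [Nat.succ_le_iff] using this

/-- `GL(k)` acts transitively on complete flags. -/
theorem CompleteFlag.exists_smul_std (F : CompleteFlag k) :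
    ∃ g : GL (Fin k) ℂ, F = g • stdFlag k := by
  choose v hv hv' using F.exists_mem_succ_notMem
  -- Each space is the previous one plus the line of one chosen vector. So the `k` vectors span
  -- everything, and being `k` in number they are independent.
  have hspan : ∀ n : ℕ, ∀ hn : n < k + 1, F.space ⟨n, hn⟩ ≤ Submodule.span ℂ (Set.range v) := by
    intro n
    induction n with
    | zero => intro hn; rw [F.space_zero rfl]; exact bot_le
    | succ n ih =>
      intro hn
      have := CompleteFlag.space_succ_eq_sup (hv ⟨n, by omega⟩) (hv' _)
      change F.space ⟨n + 1, hn⟩ = F.space ⟨n, by omega⟩ ⊔ _ at this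
      rw [this]
      refine sup_le (ih _) (Submodule.span_mono ?_)
      simp
  have hli : LinearIndependent ℂ v := by
    apply linearIndependent_of_top_le_span_of_card_eq_finrank
    · rw [← F.space_last (i := ⟨k, by omega⟩) rfl]
      exact hspan k _
    · simp
  let M : Matrix (Fin k) (Fin k) ℂ := (Matrix.of v).transpose
  have hM : IsUnit M := Matrix.linearIndependent_cols_iff_isUnit.mp hli
  exact ⟨hM.unit, eq_smul_stdFlag fun a => hv a⟩

/-! ### Relative position -/

theorem RelPos.smul {w : Equiv.Perm (Fin k)} {F F' : CompleteFlag k} (h : RelPos w F F')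
    (g : GL (Fin k) ℂ) : RelPos w (g • F) (g • F') := by
  obtain ⟨u, h1, h2⟩ := h
  exact ⟨u * g⁻¹, by rw [mul_smul, inv_smul_smul, h1], by rw [mul_smul, inv_smul_smul, h2]⟩

theorem relPos_smul_iff {w : Equiv.Perm (Fin k)} {F F' : CompleteFlag k} {g : GL (Fin k) ℂ} :
    RelPos w (g • F) (g • F') ↔ RelPos w F F' :=
  ⟨fun h => by simpa using h.smul g⁻¹, fun h => h.smul g⟩

theorem RelPos.symm {w : Equiv.Perm (Fin k)} {F F' : CompleteFlag k} (h : RelPos w F F') :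
    RelPos w⁻¹ F' F := by
  obtain ⟨u, h1, h2⟩ := h
  refine ⟨permGL w⁻¹ * u, ?_, ?_⟩
  · rw [mul_smul, h2, permGL_smul_coordFlag, inv_mul_cancel]; rfl
  · rw [mul_smul, h1, stdFlag, permGL_smul_coordFlag, mul_one]

theorem relPos_std_coordFlag (w : Equiv.Perm (Fin k)) : RelPos w (stdFlag k) (coordFlag w) :=
  ⟨1, one_smul _ _, one_smul _ _⟩

theorem relPos_one_iff {F F' : CompleteFlag k} : RelPos 1 F F' ↔ F = F' := by
  constructor
  · rintro ⟨g, h1, h2⟩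
    exact MulAction.injective g (h1.trans h2.symm)
  · rintro rfl
    obtain ⟨g, rfl⟩ := F.exists_smul_std
    exact (relPos_std_coordFlag 1).smul g

theorem transverse_std_ant : Transverse (stdFlag k) (antFlag k) := relPos_std_coordFlag _

theorem longest_inv : (longest k)⁻¹ = longest k :=
  inv_eq_of_mul_eq_one_left longest_mul_longest

theorem Transverse.symm {F F' : CompleteFlag k} (h : Transverse F F') : Transverse F' F := by
  have := RelPos.symm h
  rwa [longest_inv] at this

/-! ### Triangular matrices -/

theorem isUpper_inv {g : GL (Fin k) ℂ} (h : IsUpper g.val) : IsUpper (g⁻¹).val := by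
  rw [← smul_stdFlag_eq_iff] at h ⊢
  rw [inv_smul_eq_iff, h]

theorem isLower_inv {g : GL (Fin k) ℂ} (h : IsLower g.val) : IsLower (g⁻¹).val := by
  rw [← smul_antFlag_eq_iff] at h ⊢
  rw [inv_smul_eq_iff, h]

theorem isLower_mul {g h : GL (Fin k) ℂ} (hg : IsLower g.val) (hh : IsLower h.val) :
    IsLower (g * h).val := by
  rw [← smul_antFlag_eq_iff] at *
  rw [mul_smul, hh, hg]

theorem mul_apply_self_of_isUpper {M N : Matrix (Fin k) (Fin k) ℂ} (hM : IsUpper M)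
    (hN : IsUpper N) (a : Fin k) : (M * N) a a = M a a * N a a := by
  rw [Matrix.mul_apply, Finset.sum_eq_single a]
  · intro b _ hb
    rcases lt_or_gt_of_ne hb with h | h
    · rw [hM a b h, zero_mul]
    · rw [hN b a h, mul_zero]
  · simp

theorem mul_apply_self_of_isLower {M N : Matrix (Fin k) (Fin k) ℂ} (hM : IsLower M)
    (hN : IsLower N) (a : Fin k) : (M * N) a a = M a a * N a a := by
  rw [Matrix.mul_apply, Finset.sum_eq_single a]
  · intro b _ hb
    rcases lt_or_gt_of_ne hb with h | h
    · rw [hN b a h, mul_zero]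
    · rw [hM a b h, zero_mul]
  · simp

theorem isUpper_apply_self_ne_zero {g : GL (Fin k) ℂ} (h : IsUpper g.val) (a : Fin k) :
    g.val a a ≠ 0 := by
  intro h0
  have := mul_apply_self_of_isUpper h (isUpper_inv h) a
  rw [← Units.val_mul, mul_inv_cancel, h0] at this
  simp at this

/-- Lower-triangular invertible matrices with `1`'s on the diagonal. -/
def IsUnipotentLower (L : GL (Fin k) ℂ) : Prop := IsLower L.val ∧ IsUnidiagonal L.val

theorem IsUnipotentLower.mul {L L' : GL (Fin k) ℂ} (h : IsUnipotentLower L)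
    (h' : IsUnipotentLower L') : IsUnipotentLower (L * L') := by
  refine ⟨isLower_mul h.1 h'.1, fun a => ?_⟩
  rw [Units.val_mul, mul_apply_self_of_isLower h.1 h'.1, h.2, h'.2, one_mul]

theorem IsUnipotentLower.inv {L : GL (Fin k) ℂ} (h : IsUnipotentLower L) :
    IsUnipotentLower L⁻¹ := by
  refine ⟨isLower_inv h.1, fun a => ?_⟩
  have := mul_apply_self_of_isLower h.1 (isLower_inv h.1) a
  rw [← Units.val_mul, mul_inv_cancel, h.2, one_mul] at this
  simpa using this.symm

theorem IsUnipotentLower.smul_ant {L : GL (Fin k) ℂ} (h : IsUnipotentLower L) :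
    L • antFlag k = antFlag k := smul_antFlag_eq_iff.mpr h.1

theorem IsUnipotentLower.inv_smul_ant {L : GL (Fin k) ℂ} (h : IsUnipotentLower L) :
    L⁻¹ • antFlag k = antFlag k := h.inv.smul_ant

/-- `L'⁻¹L` is lower unipotent and, fixing the standard flag, upper triangular; hence it is the
identity. -/
theorem IsUnipotentLower.eq_of_smul_std {L L' : GL (Fin k) ℂ} (h : IsUnipotentLower L)
    (h' : IsUnipotentLower L') (e : L • stdFlag k = L' • stdFlag k) : L = L' := by
  rw [← inv_smul_eq_iff, smul_smul, smul_stdFlag_eq_iff] at e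
  have hN := h'.inv.mul h
  have : L'⁻¹ * L = 1 := by
    ext a b
    rcases lt_trichotomy a b with hab | rfl | hab
    · rw [hN.1 a b hab, Units.val_one, Matrix.one_apply_ne hab.ne]
    · rw [hN.2 a]; simp
    · rw [e a b hab, Units.val_one, Matrix.one_apply_ne hab.ne']
  rwa [inv_mul_eq_one, eq_comm] at this

/-! ### Flags transverse to the antistandard flag -/

/-- Gaussian elimination on flags: the `(a+1)`-st space contains a vector whose first nonzero
coordinate is the `a`-th. Scaled to have a `1` there, these vectors are the columns of `L`. -/
theorem exists_isUnipotentLower {F : CompleteFlag k}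
    (h : ∀ (m : Fin (k + 1)), ∀ x ∈ F.space m, (∀ a : Fin k, (a : ℕ) < m → x a = 0) → x = 0) :
    ∃ L : GL (Fin k) ℂ, IsUnipotentLower L ∧ F = L • stdFlag k := by
  have key : ∀ a : Fin k, ∃ v ∈ F.space a.succ, v a = 1 ∧ ∀ b < a, v b = 0 := by
    intro a
    set W := (antFlag k).space ⟨k - a, by omega⟩ with hW
    -- The dimensions `a + 1` and `k - a` add up to more than `k`.
    have hne : F.space a.succ ⊓ W ≠ ⊥ := by
      intro h0
      have := Submodule.finrank_add_finrank_le_of_disjoint (disjoint_iff.mpr h0)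
      rw [F.finrank_space, hW, CompleteFlag.finrank_space, Module.finrank_fin_fun] at this
      have := a.2
      simp at *
      omega
    obtain ⟨x, ⟨hx1, hx2⟩, hx0⟩ := Submodule.exists_mem_ne_zero_of_ne_bot hne
    rw [SetLike.mem_coe, hW, mem_antFlag] at hx2
    have hx3 : ∀ b < a, x b = 0 := fun b hb => hx2 b (by
      have := a.2
      have : (b : ℕ) < a := hb
      simp only; omega)
    have hxa : x a ≠ 0 := by
      intro hxa
      refine hx0 (h _ x hx1 fun b hb => ?_)
      rcases (show b ≤ a from Nat.lt_succ_iff.mp hb).lt_or_eq with h' | rfl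
      · exact hx3 b h'
      · exact hxa
    exact ⟨(x a)⁻¹ • x, Submodule.smul_mem _ _ hx1, by simp [hxa],
      fun b hb => by simp [hx3 b hb]⟩
  choose v hv1 hv2 hv3 using key
  let M : Matrix (Fin k) (Fin k) ℂ := (Matrix.of v).transpose
  have hM1 : IsLower M := fun a b hab => hv3 b a hab
  have hM2 : IsUnidiagonal M := hv2
  have hdet : M.det = 1 := by
    rw [Matrix.det_of_isLowerTriangular M fun a b hab => hM1 a b hab]
    exact Finset.prod_eq_one fun a _ => hM2 a
  have hM : IsUnit M := (Matrix.isUnit_iff_isUnit_det _).mpr (by simp [hdet])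
  exact ⟨hM.unit, ⟨hM1, hM2⟩, eq_smul_stdFlag fun a => hv1 a⟩

theorem IsUnipotentLower.transverse {L : GL (Fin k) ℂ} (h : IsUnipotentLower L) :
    Transverse (L • stdFlag k) (antFlag k) := by
  have := RelPos.smul transverse_std_ant L
  rwa [h.smul_ant] at this

theorem Transverse.eq_zero_of_mem {F : CompleteFlag k} (hF : Transverse F (antFlag k))
    (m : Fin (k + 1)) (x : Fin k → ℂ) (hx : x ∈ F.space m)
    (hx' : ∀ a : Fin k, (a : ℕ) < m → x a = 0) : x = 0 := by
  obtain ⟨g, h1, h2⟩ := hF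
  have hs := mulVec_mem_smul (g := g) hx
  have ha : x ∈ (antFlag k).space ⟨k - m, by omega⟩ := by
    rw [mem_antFlag]
    intro a ha
    exact hx' a (by simp only at ha; omega)
  have ha' := mulVec_mem_smul (g := g) ha
  change _ ∈ (g • antFlag k).space _ at ha'
  rw [h2, ← antFlag, mem_antFlag] at ha'
  rw [h1, mem_stdFlag] at hs
  have h0 : g.val.mulVec x = 0 := by
    ext a
    by_cases h : (m : ℕ) ≤ a
    · exact hs a h
    · exact ha' a (by simp only; have := m.2; omega)
  rw [← GL_inv_mulVec_mulVec g x, h0, Matrix.mulVec_zero]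

theorem transverse_antFlag_iff {F : CompleteFlag k} :
    Transverse F (antFlag k) ↔ ∃ L : GL (Fin k) ℂ, IsUnipotentLower L ∧ F = L • stdFlag k := by
  refine ⟨fun h => exists_isUnipotentLower h.eq_zero_of_mem, ?_⟩
  rintro ⟨L, hL, rfl⟩
  exact hL.transverse

/-- The submatrix is `M` restricted to the first `m` coordinate vectors and then projected to the
first `m` coordinates. Its kernel is the part of the `m`-th space of `M • stdFlag k` killed by this
projection, pulled back by `M`. -/
theorem principalMinor_ne_zero_iff {m : ℕ} (hm : m ≤ k) (M : GL (Fin k) ℂ) :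
    principalMinor m hm M.val ≠ 0 ↔
      ∀ x ∈ (M • stdFlag k).space ⟨m, Nat.lt_succ_of_le hm⟩,
        (∀ a : Fin k, (a : ℕ) < m → x a = 0) → x = 0 := by
  -- For a vector supported on the first `m` coordinates, the submatrix computes the first `m`
  -- coordinates of its image.
  have hext : ∀ (v : Fin k → ℂ), (∀ a : Fin k, m ≤ a → v a = 0) → ∀ b : Fin m,
      (M.val.submatrix (Fin.castLE hm) (Fin.castLE hm)).mulVec (fun c => v (Fin.castLE hm c)) b
        = M.val.mulVec v (Fin.castLE hm b) := by
    intro v hv b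
    simp only [Matrix.mulVec, dotProduct, Matrix.submatrix_apply]
    refine Finset.sum_of_injOn (Fin.castLE hm) (Fin.castLE_injective hm).injOn
      (fun _ _ => Finset.mem_coe.mpr (Finset.mem_univ _)) ?_ (fun _ _ => rfl)
    intro a _ ha
    rw [hv a, mul_zero]
    by_contra! hlt
    exact ha ⟨⟨a, hlt⟩, by simp, rfl⟩
  rw [principalMinor, ← isUnit_iff_ne_zero, ← Matrix.isUnit_iff_isUnit_det,
    ← Matrix.mulVec_injective_iff_isUnit, ← Matrix.coe_mulVecLin, injective_iff_map_eq_zero]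
  constructor
  · intro h x hx hx'
    rw [mem_smul_space, mem_stdFlag] at hx
    have h1 := h (fun c => (M⁻¹).val.mulVec x (Fin.castLE hm c)) (by
      ext b
      rw [Matrix.mulVecLin_apply, hext _ hx, GL_mulVec_inv_mulVec]
      exact hx' _ b.2)
    have h2 : (M⁻¹).val.mulVec x = 0 := by
      ext a
      by_cases ha : m ≤ a
      · exact hx a ha
      · exact congrFun h1 ⟨a, by omega⟩
    rw [← GL_mulVec_inv_mulVec M x, h2, Matrix.mulVec_zero]
  · intro h y hy
    set v : Fin k → ℂ := fun a => if ha : (a : ℕ) < m then y ⟨a, ha⟩ else 0 with hv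
    have hv0 : ∀ a : Fin k, m ≤ a → v a = 0 := fun a ha => by simp [hv, ha]
    have hvy : (fun c => v (Fin.castLE hm c)) = y := by ext c; simp [hv]
    have h1 := h (M.val.mulVec v) (mulVec_mem_smul (mem_stdFlag.mpr hv0)) (by
      intro a ha
      have := hext v hv0 ⟨a, ha⟩
      rw [hvy] at this
      exact this.symm.trans (congrFun hy _))
    have h2 : v = 0 := by rw [← GL_inv_mulVec_mulVec M v, h1, Matrix.mulVec_zero]
    rw [← hvy, h2]; rfl

/-! ### Braid matrices -/

theorem lo_ne_hi (i : Fin (k - 1)) : lo i ≠ hi i := by simp [lo, hi]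

theorem braidGL_col_lo (i : Fin (k - 1)) (z : ℂ) :
    (braidGL i z).val.col (lo i) = Pi.single (lo i) z + Pi.single (hi i) 1 := by
  ext a
  change braidMatrix i z a (lo i) = _
  have := lo_ne_hi i
  by_cases ha : a = lo i
  · subst ha; simp [braidMatrix, this]
  by_cases hb : a = hi i
  · subst hb; simp [braidMatrix, this.symm]
  · simp [braidMatrix, ha, hb, Ne.symm ha]

theorem braidGL_col_hi (i : Fin (k - 1)) (z : ℂ) :
    (braidGL i z).val.col (hi i) = - Pi.single (lo i) 1 := by
  ext a
  change braidMatrix i z a (hi i) = _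
  have := lo_ne_hi i
  by_cases ha : a = lo i
  · subst ha; simp [braidMatrix, this.symm]
  by_cases hb : a = hi i
  · subst hb; simp [braidMatrix, this.symm]
  · simp [braidMatrix, ha, hb, Ne.symm hb]

theorem braidGL_col_of_ne {i : Fin (k - 1)} (z : ℂ) {b : Fin k} (h1 : b ≠ lo i) (h2 : b ≠ hi i) :
    (braidGL i z).val.col b = Pi.single b 1 := by
  ext a
  change braidMatrix i z a b = _
  by_cases ha : a = lo i
  · subst ha; simp [braidMatrix, h1, h2, h1.symm]
  by_cases hb : a = hi i
  · subst hb; simp [braidMatrix, ha, h1, h2.symm]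
  · simp only [braidMatrix, Matrix.of_apply, ha, hb, if_false]
    simp [Pi.single_apply, eq_comm]

/-- The two flags agree except possibly in the space affected by the letter `i`. -/
def AgreeOff (i : Fin (k - 1)) (F F' : CompleteFlag k) : Prop :=
  ∀ j, j ≠ (lo i).succ → F.space j = F'.space j

theorem simple_inv (i : Fin (k - 1)) : (simple i)⁻¹ = simple i := Equiv.swap_inv _ _

theorem simple_apply_le_iff (i : Fin (k - 1)) {j : Fin (k + 1)} (hj : j ≠ (lo i).succ)
    (a : Fin k) : (j : ℕ) ≤ (simple i a : Fin k) ↔ (j : ℕ) ≤ a := by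
  have hj' : (j : ℕ) ≠ i + 1 := fun h => hj (Fin.ext h)
  by_cases ha : a = lo i
  · subst ha; simp only [simple, Equiv.swap_apply_left]; simp [lo, hi]; omega
  by_cases hb : a = hi i
  · subst hb; simp only [simple, Equiv.swap_apply_right]; simp [lo, hi]; omega
  · rw [simple, Equiv.swap_apply_of_ne_of_ne ha hb]

theorem agreeOff_std_coordFlag (i : Fin (k - 1)) : AgreeOff i (stdFlag k) (coordFlag (simple i)) := by
  intro j hj
  ext x
  rw [mem_stdFlag, mem_coordFlag, simple_inv]
  simp only [simple_apply_le_iff i hj]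

theorem RelPos.agreeOff {i : Fin (k - 1)} {F F' : CompleteFlag k} (h : RelPos (simple i) F F') :
    AgreeOff i F F' := by
  obtain ⟨g, h1, h2⟩ := h
  rw [← eq_inv_smul_iff] at h1 h2
  intro j hj
  rw [h1, h2, smul_space, smul_space, agreeOff_std_coordFlag i j hj]

theorem eq_braidGL_smul_std {i : Fin (k - 1)} {F : CompleteFlag k} {z : ℂ}
    (h : AgreeOff i (stdFlag k) F)
    (hz : Pi.single (lo i) z + Pi.single (hi i) 1 ∈ F.space (lo i).succ) :
    F = braidGL i z • stdFlag k := by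
  refine eq_smul_stdFlag fun a => ?_
  by_cases ha : a = lo i
  · subst ha; rwa [braidGL_col_lo]
  have ha' : a.succ ≠ (lo i).succ := fun h => ha (Fin.succ_injective _ h)
  rw [← h _ ha']
  by_cases hb : a = hi i
  · subst hb
    rw [braidGL_col_hi]
    exact Submodule.neg_mem _ (single_mem_coordFlag _ (by simp [lo, hi]))
  · rw [braidGL_col_of_ne z ha hb]
    exact single_mem_coordFlag _ (by simp)

theorem coordFlag_simple (i : Fin (k - 1)) : coordFlag (simple i) = braidGL i 0 • stdFlag k := by
  refine eq_braidGL_smul_std (agreeOff_std_coordFlag i) ?_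
  rw [Pi.single_zero, zero_add]
  exact single_mem_coordFlag _ (by rw [simple_inv, simple, Equiv.swap_apply_right]; simp)

/-- The matrix sends `e_hi` to `-e_lo` and `e_lo` to `z e_lo + e_hi`. The extra term `z e_lo` does
no harm because `e_lo` enters the flag of `w` before `e_hi`, which is what `h` says. -/
theorem braidGL_smul_coordFlag {i : Fin (k - 1)} {w : Equiv.Perm (Fin k)}
    (h : w⁻¹ (lo i) < w⁻¹ (hi i)) (z : ℂ) :
    braidGL i z • coordFlag (simple i * w) = coordFlag w := by
  apply CompleteFlag.eq_of_le
  intro j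
  rw [smul_space, Submodule.map_le_iff_le_comap]
  refine Submodule.span_le.mpr ?_
  rintro _ ⟨b, hb, rfl⟩
  simp only [Set.mem_ofPred_eq] at hb
  change (braidGL i z).val.mulVec (Pi.single _ 1) ∈ (coordFlag w).space j
  rw [Matrix.mulVec_single_one, Equiv.Perm.mul_apply]
  by_cases h1 : w b = lo i
  · rw [h1, simple, Equiv.swap_apply_left, braidGL_col_hi]
    exact Submodule.neg_mem _ (single_mem_coordFlag _ (by simpa [← h1] using hb))
  by_cases h2 : w b = hi i
  · rw [h2, simple, Equiv.swap_apply_right, braidGL_col_lo]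
    have h3 : w⁻¹ (hi i) = b := by rw [← h2]; simp
    refine Submodule.add_mem _ (single_mem_coordFlag _ ?_) (single_mem_coordFlag _ ?_)
    · rw [h3] at h; exact lt_trans h hb
    · rwa [h3]
  · rw [simple, Equiv.swap_apply_of_ne_of_ne h1 h2, braidGL_col_of_ne z h1 h2]
    exact single_mem_coordFlag _ (by simpa using hb)

theorem lo_lt_hi (i : Fin (k - 1)) : lo i < hi i := by simp [lo, hi, Fin.lt_def]

theorem relPos_std_braidGL (i : Fin (k - 1)) (z : ℂ) :
    RelPos (simple i) (stdFlag k) (braidGL i z • stdFlag k) := by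
  have h := braidGL_smul_coordFlag (i := i) (w := 1) (by simpa using lo_lt_hi i) z
  have h2 : RelPos (simple i) (braidGL i z • stdFlag k) (stdFlag k) :=
    ⟨(braidGL i z)⁻¹, inv_smul_smul _ _, by rw [stdFlag, inv_smul_eq_iff, ← h, mul_one]⟩
  have := h2.symm
  rwa [simple_inv] at this

/-- Scale `x` so that its `hi i` coordinate is `1`. The coordinates before `lo i` lie in a smaller
space shared with the standard flag and can be subtracted. -/
theorem AgreeOff.single_mem {i : Fin (k - 1)} {F : CompleteFlag k} (h : AgreeOff i (stdFlag k) F)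
    {x : Fin k → ℂ} (hx : x ∈ F.space (lo i).succ) (hx0 : x (hi i) ≠ 0) :
    Pi.single (lo i) ((x (hi i))⁻¹ * x (lo i)) + Pi.single (hi i) 1 ∈ F.space (lo i).succ := by
  have hx2 : x ∈ F.space (hi i).succ := F.mono (by simp [Fin.le_def, lo, hi]) hx
  rw [← h _ (by simp [lo, hi]), mem_stdFlag] at hx2
  have hle : F.space (lo i).castSucc ≤ F.space (lo i).succ := F.mono (Fin.castSucc_le_succ _)
  have hd : Pi.single (lo i) ((x (hi i))⁻¹ * x (lo i)) + Pi.single (hi i) 1 - (x (hi i))⁻¹ • x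
      ∈ F.space (lo i).castSucc := by
    rw [← h _ (by simp [Fin.ext_iff]), mem_stdFlag]
    intro a ha
    have hne := lo_ne_hi i
    by_cases h1 : a = lo i
    · subst h1; simp [hne]
    by_cases h2 : a = hi i
    · subst h2; simp [hne.symm, hx0]
    · rw [Pi.sub_apply, Pi.smul_apply, hx2 a, Pi.add_apply, Pi.single_eq_of_ne h1,
        Pi.single_eq_of_ne h2]
      · simp
      · rw [Fin.ext_iff] at h1 h2
        simp [lo, hi] at *
        omega
  have := Submodule.add_mem _ (hle hd) (Submodule.smul_mem _ (x (hi i))⁻¹ hx)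
  rwa [sub_add_cancel] at this

/-- Flags agreeing with the standard one off a single space form a projective line. Removing the
standard flag itself leaves an affine line, with coordinate `z`. -/
theorem relPos_simple_std_iff {i : Fin (k - 1)} {F : CompleteFlag k} :
    RelPos (simple i) (stdFlag k) F ↔ ∃ z, F = braidGL i z • stdFlag k := by
  constructor
  · intro h
    have hag := h.agreeOff
    have hnot : ¬ F.space (lo i).succ ≤ (stdFlag k).space (lo i).succ := by
      intro hle
      have hF : F = stdFlag k := by
        refine CompleteFlag.eq_of_le fun j => ?_
        by_cases hj : j = (lo i).succ
        · rwa [hj]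
        · rw [hag j hj]
      obtain ⟨g, h1, h2⟩ := h
      rw [hF, h1] at h2
      have h3 : (Pi.single (hi i) 1 : Fin k → ℂ) ∈ (coordFlag (simple i)).space (lo i).succ :=
        single_mem_coordFlag _ (by rw [simple_inv, simple, Equiv.swap_apply_right]; simp)
      rw [← h2, mem_stdFlag] at h3
      simpa using h3 (hi i) (by simp [lo, hi])
    obtain ⟨x, hx, hx'⟩ := Set.not_subset.mp hnot
    refine ⟨_, eq_braidGL_smul_std hag (hag.single_mem hx fun h0 => hx' ?_)⟩
    have hx2 : x ∈ F.space (hi i).succ := F.mono (by simp [Fin.le_def, lo, hi]) hx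
    rw [← hag _ (by simp [lo, hi]), mem_stdFlag] at hx2
    rw [SetLike.mem_coe, mem_stdFlag]
    intro a ha
    by_cases h2 : a = hi i
    · rw [h2, h0]
    · refine hx2 a ?_
      rw [Fin.ext_iff] at h2
      simp [lo, hi] at *
      omega
  · rintro ⟨z, rfl⟩
    exact relPos_std_braidGL i z

theorem braidGL_smul_std_injective (i : Fin (k - 1)) {z z' : ℂ}
    (h : braidGL i z • stdFlag k = braidGL i z' • stdFlag k) : z = z' := by
  rw [eq_comm, ← inv_smul_eq_iff, smul_smul, smul_stdFlag_eq_iff] at h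
  have h1 := h _ _ (lo_lt_hi i)
  -- This exhibits column `lo i` of `B_i(z)⁻¹B_i(z')`. Its entry in row `hi i` is `-(z' - z)`, which
  -- upper-triangularity forces to vanish.
  have h2 : (braidGL i z).val.mulVec (Pi.single (lo i) 1 - Pi.single (hi i) (z' - z))
      = (braidGL i z').val.mulVec (Pi.single (lo i) 1) := by
    have : (Pi.single (hi i) (z' - z) : Fin k → ℂ) = (z' - z) • Pi.single (hi i) 1 := by
      rw [← Pi.single_smul]; simp
    rw [Matrix.mulVec_sub, this, Matrix.mulVec_smul, Matrix.mulVec_single_one,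
      Matrix.mulVec_single_one, Matrix.mulVec_single_one, braidGL_col_lo, braidGL_col_hi,
      braidGL_col_lo]
    ext a
    by_cases ha : a = lo i
    · subst ha; simp [add_comm]
    · simp [ha]
  have h3 := congrArg ((braidGL i z)⁻¹).val.mulVec h2
  rw [GL_inv_mulVec_mulVec, Matrix.mulVec_mulVec, ← Units.val_mul, Matrix.mulVec_single_one] at h3
  have h4 := congrFun h3 (hi i)
  rw [Matrix.col_apply, h1] at h4
  simp [(lo_ne_hi i).symm] at h4
  exact sub_eq_zero.mp (by linear_combination h4)

/-- Sliding an upper-triangular matrix through one braid matrix. -/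
theorem isUpper_smul_braidGL {U : GL (Fin k) ℂ} (hU : IsUpper U.val) (i : Fin (k - 1)) (z : ℂ) :
    U • braidGL i z • stdFlag k = braidGL i ((U.val (lo i) (lo i) * z + U.val (lo i) (hi i)) /
      U.val (hi i) (hi i)) • stdFlag k := by
  have h := (relPos_std_braidGL i z).smul U
  rw [smul_stdFlag_eq_iff.mpr hU] at h
  have hx : (Pi.single (lo i) z + Pi.single (hi i) 1 : Fin k → ℂ)
      ∈ (braidGL i z • stdFlag k).space (lo i).succ := by
    rw [← braidGL_col_lo, ← Matrix.mulVec_single_one]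
    exact mulVec_mem_smul (single_mem_coordFlag _ (by simp))
  have hy := mulVec_mem_smul (g := U) hx
  have hlo : U.val.mulVec (Pi.single (lo i) z + Pi.single (hi i) 1) (lo i)
      = U.val (lo i) (lo i) * z + U.val (lo i) (hi i) := by
    simp [Matrix.mulVec_add, mul_comm]
  have hhi : U.val.mulVec (Pi.single (lo i) z + Pi.single (hi i) 1) (hi i)
      = U.val (hi i) (hi i) := by
    simp [Matrix.mulVec_add, hU _ _ (lo_lt_hi i)]
  have := h.agreeOff.single_mem hy (by rw [hhi]; exact isUpper_apply_self_ne_zero hU _)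
  rw [hlo, hhi, inv_mul_eq_div] at this
  exact eq_braidGL_smul_std h.agreeOff this

/-! ### Reduced words -/

theorem simple_apply_lt {j : Fin (k - 1)} {p q : Fin k} (hpq : p < q)
    (h : ¬(p = lo j ∧ q = hi j)) : simple j p < simple j q := by
  unfold simple
  rw [Equiv.swap_apply_def, Equiv.swap_apply_def]
  simp only [Fin.ext_iff, Fin.lt_def, lo, hi] at *
  split_ifs <;> simp at * <;> omega

/-- If `w⁻¹` inverts `p < q`, then `(p q) w` is spelled by a word shorter than any given word
spelling `w`. -/
theorem exists_shorter_word (a : List (Fin (k - 1))) {p q : Fin k} (hpq : p < q)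
    (h : (a.map simple).prod⁻¹ q < (a.map simple).prod⁻¹ p) :
    ∃ b : List (Fin (k - 1)), b.length < a.length ∧
      (b.map simple).prod = Equiv.swap p q * (a.map simple).prod := by
  induction a generalizing p q with
  | nil => simp at h; exact absurd hpq h.asymm
  | cons j a ih =>
    rw [List.map_cons, List.prod_cons] at *
    -- If the first letter is the transposition `(p q)` itself, it is deleted. Otherwise it
    -- preserves the order of `p` and `q`, and the induction applies to their images after
    -- conjugation.
    by_cases hj : p = lo j ∧ q = hi j
    · obtain ⟨rfl, rfl⟩ := hj
      exact ⟨a, by simp, by rw [← mul_assoc, simple, Equiv.swap_mul_self, one_mul]⟩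
    · rw [mul_inv_rev, simple_inv] at h
      obtain ⟨b, hb, hb'⟩ := ih (simple_apply_lt hpq hj) h
      refine ⟨j :: b, by simpa using hb, ?_⟩
      rw [List.map_cons, List.prod_cons, hb', ← mul_assoc, ← mul_assoc,
        Equiv.mul_swap_eq_swap_mul]
      simp [simple]

theorem IsReducedWord.tail {i : Fin (k - 1)} {a : List (Fin (k - 1))} {w : Equiv.Perm (Fin k)}
    (h : IsReducedWord w (i :: a)) : IsReducedWord (a.map simple).prod a := by
  refine ⟨rfl, fun b hb => ?_⟩
  have := h.2 (i :: b) (by rw [← h.1]; simp [hb])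
  simpa using this

/-- If the order were reversed, the exchange argument would spell `s_i · prod a` by a word shorter
than `a`, against minimality of `i :: a`. -/
theorem IsReducedWord.lt {i : Fin (k - 1)} {a : List (Fin (k - 1))} {w : Equiv.Perm (Fin k)}
    (h : IsReducedWord w (i :: a)) :
    (a.map simple).prod⁻¹ (lo i) < (a.map simple).prod⁻¹ (hi i) := by
  by_contra hlt
  rcases (not_lt.mp hlt).lt_or_eq with hlt | heq
  · obtain ⟨b, hb, hb'⟩ := exists_shorter_word a (lo_lt_hi i) hlt
    have := h.2 b (by rw [hb', ← h.1]; rfl)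
    simp at this
    omega
  · exact lo_ne_hi i (Equiv.injective _ heq.symm)

/-- Move `F'` and `F''` to the standard flag and the flag of `w`. Then `F` becomes `B_i(z) • stdFlag
k`, and the same `B_i(z)` carries the flag of `s_i w` to that of `w`. -/
theorem RelPos.simple_mul {i : Fin (k - 1)} {w : Equiv.Perm (Fin k)} {F F' F'' : CompleteFlag k}
    (h : RelPos (simple i) F F') (h' : RelPos w F' F'') (hw : w⁻¹ (lo i) < w⁻¹ (hi i)) :
    RelPos (simple i * w) F F'' := by
  obtain ⟨g, h1, h2⟩ := h'
  have h3 := (h.smul g).symm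
  rw [simple_inv, h1, relPos_simple_std_iff] at h3
  obtain ⟨z, hz⟩ := h3
  refine (relPos_smul_iff (g := g)).mp ?_
  rw [h2, hz, ← braidGL_smul_coordFlag hw z]
  exact (relPos_std_coordFlag _).smul _

theorem RelPos.exists_simple {i : Fin (k - 1)} {w : Equiv.Perm (Fin k)} {F F'' : CompleteFlag k}
    (h : RelPos (simple i * w) F F'') : ∃ F', RelPos (simple i) F F' ∧ RelPos w F' F'' := by
  obtain ⟨g, h1, h2⟩ := h
  rw [← eq_inv_smul_iff] at h1 h2
  subst h1 h2
  refine ⟨g⁻¹ • coordFlag (simple i), (relPos_std_coordFlag _).smul _, RelPos.smul ?_ _⟩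
  have := (relPos_std_coordFlag w).smul (permGL (simple i))
  rwa [stdFlag, permGL_smul_coordFlag, permGL_smul_coordFlag, mul_one] at this

/-- The vector comes from a basis adapted to both flags. It lets the relative position constrain an
unknown flag in `eq_coordFlag_simple`. -/
theorem RelPos.exists_jump {w : Equiv.Perm (Fin k)} {F F' : CompleteFlag k} (h : RelPos w F F')
    (a : Fin k) : ∃ x ∈ F.space a.succ, x ∈ F'.space (w⁻¹ a).succ ∧ x ∉ F.space a.castSucc := by
  obtain ⟨g, h1, h2⟩ := h
  rw [← eq_inv_smul_iff] at h1 h2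
  subst h1 h2
  refine ⟨(g⁻¹).val.mulVec (Pi.single a 1), mulVec_mem_smul (single_mem_coordFlag _ (by simp)),
    mulVec_mem_smul (single_mem_coordFlag _ (by simp)), fun h => ?_⟩
  rw [mem_smul_space, GL_inv_mulVec_mulVec, mem_stdFlag] at h
  simpa using h a (by simp)

theorem eq_coordFlag_simple {i : Fin (k - 1)} {w : Equiv.Perm (Fin k)} {F' : CompleteFlag k}
    (hw : w⁻¹ (lo i) < w⁻¹ (hi i)) (h : RelPos (simple i) (stdFlag k) F')
    (h' : RelPos w F' (coordFlag (simple i * w))) : F' = coordFlag (simple i) := by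
  have hag := h.agreeOff
  obtain ⟨x, hx1, hx2, hx3⟩ := h'.exists_jump (lo i)
  -- In the flag of `s_i w`, the vector `e_lo` enters only at index `w⁻¹ (hi i)`, after the space
  -- containing `x`. Thus the coordinate of `F'` on the affine line is `0`.
  have hx0 : x (lo i) = 0 := by
    rw [mem_coordFlag] at hx2
    refine hx2 _ ?_
    rw [mul_inv_rev, simple_inv, Equiv.Perm.mul_apply, simple, Equiv.swap_apply_left]
    simpa [Nat.succ_le_iff] using hw
  have hx4 : x (hi i) ≠ 0 := by
    intro h0
    have hx5 : x ∈ F'.space (hi i).succ := F'.mono (by simp [Fin.le_def, lo, hi]) hx1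
    rw [← hag _ (by simp [lo, hi]), mem_stdFlag] at hx5
    rw [← hag _ (by simp [Fin.ext_iff]), mem_stdFlag] at hx3
    refine hx3 fun a ha => ?_
    by_cases h1 : a = lo i
    · rw [h1, hx0]
    by_cases h2 : a = hi i
    · rw [h2, h0]
    refine hx5 a ?_
    rw [Fin.ext_iff] at h1 h2
    simp [lo, hi] at *
    omega
  have := hag.single_mem hx1 hx4
  rw [hx0, mul_zero] at this
  rw [coordFlag_simple]
  exact eq_braidGL_smul_std hag this

theorem RelPos.unique_simple {i : Fin (k - 1)} {w : Equiv.Perm (Fin k)}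
    {F F₁ F₂ F'' : CompleteFlag k} (hw : w⁻¹ (lo i) < w⁻¹ (hi i)) (h₁ : RelPos (simple i) F F₁)
    (h₁' : RelPos w F₁ F'') (h₂ : RelPos (simple i) F F₂) (h₂' : RelPos w F₂ F'') : F₁ = F₂ := by
  obtain ⟨g, h1, h2⟩ := h₁.simple_mul h₁' hw
  have key : ∀ F', RelPos (simple i) F F' → RelPos w F' F'' → g • F' = coordFlag (simple i) := by
    intro F' h h'
    have h := h.smul g
    have h' := h'.smul g
    rw [h1] at h
    rw [h2] at h'
    exact eq_coordFlag_simple hw h h'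
  exact MulAction.injective g ((key _ h₁ h₁').trans (key _ h₂ h₂').symm)

/-! ### Chains of flags -/

/-- A chain along `β` with given first and last flags. -/
structure IsChainBetween (β : List (Fin (k - 1))) (F : CompleteFlag k)
    (Fs : List (CompleteFlag k)) (F' : CompleteFlag k) : Prop where
  isChain : IsChain β Fs
  head : Fs.head? = some F
  getLast : Fs.getLast? = some F'

theorem isChainBetween_nil_iff {F F' : CompleteFlag k} {Fs : List (CompleteFlag k)} :
    IsChainBetween [] F Fs F' ↔ Fs = [F] ∧ F = F' := by
  constructor
  · rintro ⟨h1, h2, h3⟩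
    cases h1
    simp_all
  · rintro ⟨rfl, rfl⟩
    exact ⟨.single F, rfl, rfl⟩

theorem isChainBetween_cons_iff {i : Fin (k - 1)} {β : List (Fin (k - 1))} {F F'' : CompleteFlag k}
    {Fs : List (CompleteFlag k)} :
    IsChainBetween (i :: β) F Fs F'' ↔
      ∃ F' Gs, Fs = F :: Gs ∧ RelPos (simple i) F F' ∧ IsChainBetween β F' Gs F'' := by
  constructor
  · rintro ⟨h1, h2, h3⟩
    cases h1 with
    | cons _ _ F F' Gs hr hc =>
      simp only [List.head?_cons, Option.some.injEq] at h2
      subst h2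
      exact ⟨F', F' :: Gs, rfl, hr, hc, rfl, by simpa using h3⟩
  · rintro ⟨F', Gs, rfl, hr, ⟨h1, h2, h3⟩⟩
    cases Gs with
    | nil => simp at h2
    | cons G Gs =>
      simp only [List.head?_cons, Option.some.injEq] at h2
      subst h2
      exact ⟨.cons _ _ _ _ _ hr h1, rfl, by simpa using h3⟩

theorem IsChainBetween.length {β : List (Fin (k - 1))} {F F' : CompleteFlag k}
    {Fs : List (CompleteFlag k)} (h : IsChainBetween β F Fs F') : Fs.length = β.length + 1 := by
  induction β generalizing F Fs with
  | nil => rw [isChainBetween_nil_iff] at h; simp [h.1]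
  | cons i β ih =>
    obtain ⟨F', Gs, rfl, -, hc⟩ := isChainBetween_cons_iff.mp h
    simp [ih hc]

theorem IsChainBetween.eq_cons {β : List (Fin (k - 1))} {F F' : CompleteFlag k}
    {Fs : List (CompleteFlag k)} (h : IsChainBetween β F Fs F') : Fs = F :: Fs.tail := by
  have := h.head
  cases Fs <;> simp_all

theorem IsChainBetween.append {β γ : List (Fin (k - 1))} {F F' F'' : CompleteFlag k}
    {Fs Gs : List (CompleteFlag k)} (h : IsChainBetween β F Fs F')
    (h' : IsChainBetween γ F' Gs F'') : IsChainBetween (β ++ γ) F (Fs ++ Gs.tail) F'' := by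
  induction β generalizing F Fs with
  | nil =>
    obtain ⟨rfl, rfl⟩ := isChainBetween_nil_iff.mp h
    rw [List.nil_append, List.singleton_append, ← h'.eq_cons]
    exact h'
  | cons i β ih =>
    obtain ⟨P, Hs, rfl, hr, hc⟩ := isChainBetween_cons_iff.mp h
    exact isChainBetween_cons_iff.mpr ⟨P, Hs ++ Gs.tail, rfl, hr, ih hc⟩

theorem IsChainBetween.exists_append {β γ : List (Fin (k - 1))} {F F'' : CompleteFlag k}
    {Hs : List (CompleteFlag k)} (h : IsChainBetween (β ++ γ) F Hs F'') :
    ∃ F' Fs Gs, Hs = Fs ++ Gs.tail ∧ IsChainBetween β F Fs F' ∧ IsChainBetween γ F' Gs F'' := by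
  induction β generalizing F Hs with
  | nil => exact ⟨F, [F], Hs, h.eq_cons, isChainBetween_nil_iff.mpr ⟨rfl, rfl⟩, h⟩
  | cons i β ih =>
    obtain ⟨P, Hs, rfl, hr, hc⟩ := isChainBetween_cons_iff.mp h
    obtain ⟨F', Fs, Gs, rfl, h1, h2⟩ := ih hc
    exact ⟨F', F :: Fs, Gs, rfl, isChainBetween_cons_iff.mpr ⟨P, Fs, rfl, hr, h1⟩, h2⟩

theorem IsChainBetween.smul {β : List (Fin (k - 1))} {F F' : CompleteFlag k}
    {Fs : List (CompleteFlag k)} (h : IsChainBetween β F Fs F') (g : GL (Fin k) ℂ) :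
    IsChainBetween β (g • F) (translate g Fs) (g • F') := by
  induction β generalizing F Fs with
  | nil =>
    obtain ⟨rfl, rfl⟩ := isChainBetween_nil_iff.mp h
    exact isChainBetween_nil_iff.mpr ⟨rfl, rfl⟩
  | cons i β ih =>
    obtain ⟨P, Hs, rfl, hr, hc⟩ := isChainBetween_cons_iff.mp h
    exact isChainBetween_cons_iff.mpr ⟨g • P, translate g Hs, rfl, hr.smul g, ih hc⟩

theorem IsChainBetween.space_eq {β : List (Fin (k - 1))} {F F' : CompleteFlag k}
    {Fs : List (CompleteFlag k)} (h : IsChainBetween β F Fs F') {s : Fin (k - 1)} (hs : s ∉ β) :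
    F.space (lo s).succ = F'.space (lo s).succ := by
  induction β generalizing F Fs with
  | nil => rw [(isChainBetween_nil_iff.mp h).2]
  | cons i β ih =>
    obtain ⟨P, Hs, rfl, hr, hc⟩ := isChainBetween_cons_iff.mp h
    rw [List.mem_cons, not_or] at hs
    rw [← ih hc hs.2]
    refine hr.agreeOff _ fun h => hs.1 ?_
    simpa [lo, Fin.ext_iff] using h

theorem IsChainBetween.relPos {a : List (Fin (k - 1))} {F F' : CompleteFlag k}
    {Fs : List (CompleteFlag k)} (h : IsChainBetween a F Fs F') {w : Equiv.Perm (Fin k)}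
    (ha : IsReducedWord w a) : RelPos w F F' := by
  induction a generalizing F Fs w with
  | nil =>
    obtain ⟨rfl, -⟩ := ha
    exact relPos_one_iff.mpr (isChainBetween_nil_iff.mp h).2
  | cons i a ih =>
    obtain ⟨P, Hs, rfl, hr, hc⟩ := isChainBetween_cons_iff.mp h
    have := hr.simple_mul (ih hc ha.tail) ha.lt
    rwa [← List.prod_cons, ← List.map_cons, ha.1] at this

/-- The first intermediate flag exists by `RelPos.exists_simple` and is unique because prepending
the letter increases length (`IsReducedWord.lt`). The rest is induction on the tail. -/
theorem RelPos.existsUnique_chain {a : List (Fin (k - 1))} {F F' : CompleteFlag k}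
    {w : Equiv.Perm (Fin k)} (ha : IsReducedWord w a) (h : RelPos w F F') :
    ∃! Fs, IsChainBetween a F Fs F' := by
  induction a generalizing F w with
  | nil =>
    obtain ⟨rfl, -⟩ := ha
    have := relPos_one_iff.mp h
    exact ⟨[F], isChainBetween_nil_iff.mpr ⟨rfl, this⟩, fun _ h => (isChainBetween_nil_iff.mp h).1⟩
  | cons i a ih =>
    rw [← ha.1, List.map_cons, List.prod_cons] at h
    obtain ⟨P, hr, hw⟩ := h.exists_simple
    obtain ⟨Fs, hFs, huniq⟩ := ih ha.tail hw
    refine ⟨F :: Fs, isChainBetween_cons_iff.mpr ⟨P, Fs, rfl, hr, hFs⟩, fun Gs hGs => ?_⟩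
    obtain ⟨P', Hs, rfl, hr', hc'⟩ := isChainBetween_cons_iff.mp hGs
    obtain rfl := RelPos.unique_simple ha.lt hr' (hc'.relPos ha.tail) hr hw
    rw [huniq Hs hc']

theorem theUnique_eq {α : Type*} [Inhabited α] {p : α → Prop} {x : α} (hx : p x)
    (h : ∀ y, p y → y = x) : theUnique p = x := by
  have hex : ∃! x, p x := ⟨x, hx, h⟩
  rw [theUnique, dif_pos hex]
  exact h _ hex.choose_spec.1

theorem IsChainBetween.eq_path {a : List (Fin (k - 1))} {F F' : CompleteFlag k}
    {Fs : List (CompleteFlag k)} (h : IsChainBetween a F Fs F') {w : Equiv.Perm (Fin k)}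
    (ha : IsReducedWord w a) : path a F F' = Fs :=
  theUnique_eq ⟨h.1, h.2, h.3⟩ fun _ hG =>
    ((h.relPos ha).existsUnique_chain ha).unique ⟨hG.1, hG.2.1, hG.2.2⟩ h

theorem RelPos.isChainBetween_path {a : List (Fin (k - 1))} {F F' : CompleteFlag k}
    {w : Equiv.Perm (Fin k)} (ha : IsReducedWord w a) (h : RelPos w F F') :
    IsChainBetween a F (path a F F') F' := by
  obtain ⟨Fs, hFs, -⟩ := h.existsUnique_chain ha
  rwa [hFs.eq_path ha]

/-! ### Translates of chains -/

theorem translate_append (g : GL (Fin k) ℂ) (Fs Gs : List (CompleteFlag k)) :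
    translate g (Fs ++ Gs) = translate g Fs ++ translate g Gs := List.map_append

theorem translate_tail (g : GL (Fin k) ℂ) (Fs : List (CompleteFlag k)) :
    translate g Fs.tail = (translate g Fs).tail := List.map_tail

theorem translate_translate (g h : GL (Fin k) ℂ) (Fs : List (CompleteFlag k)) :
    translate g (translate h Fs) = translate (g * h) Fs := by
  simp [translate, mul_smul]

theorem translate_one (Fs : List (CompleteFlag k)) : translate (1 : GL (Fin k) ℂ) Fs = Fs := by
  simp [translate]

theorem translate_injective (g : GL (Fin k) ℂ) : Function.Injective (translate g) :=
  List.map_injective_iff.mpr (MulAction.injective g)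

theorem translate_translate_inv (g : GL (Fin k) ℂ) (Fs : List (CompleteFlag k)) :
    translate g (translate g⁻¹ Fs) = Fs := by
  rw [translate_translate, mul_inv_cancel, translate_one]

/-! ### Coordinates of chains -/

theorem chart_nil (z : List ℂ) : chart ([] : List (Fin (k - 1))) z = [stdFlag k] := by
  simp [chart, ofMatrix_eq_smul]

theorem scanl_mul_eq_map {G : Type*} [Monoid G] (g : G) (l : List G) :
    l.scanl (· * ·) g = (l.scanl (· * ·) 1).map (g * ·) := by
  induction l generalizing g with
  | nil => simp
  | cons a l ih =>
    rw [List.scanl_cons, List.scanl_cons, ih, ih (1 * a), one_mul]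
    simp [mul_assoc]

/-- After the first letter, the chart is the chart of the remaining word moved by the first braid
matrix. Inductions on coordinates use this recursion. -/
theorem chart_cons (i : Fin (k - 1)) (β : List (Fin (k - 1))) (z : ℂ) (zs : List ℂ) :
    chart (i :: β) (z :: zs) = stdFlag k :: translate (braidGL i z) (chart β zs) := by
  rw [chart, List.zipWith_cons_cons, List.scanl_cons, one_mul, scanl_mul_eq_map]
  simp [chart, translate, ofMatrix_eq_smul, mul_smul]

theorem braidProd_cons (i : Fin (k - 1)) (β : List (Fin (k - 1))) (z : ℂ) (zs : List ℂ) :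
    braidProd (i :: β) (z :: zs) = braidGL i z * braidProd β zs := by
  simp [braidProd]

theorem braidProd_append {β γ : List (Fin (k - 1))} {z z' : List ℂ} (hz : z.length = β.length) :
    braidProd (β ++ γ) (z ++ z') = braidProd β z * braidProd γ z' := by
  rw [braidProd, List.zipWith_append hz.symm, List.prod_append]
  rfl

theorem isChainBetween_chart {β : List (Fin (k - 1))} {z : List ℂ} (hz : z.length = β.length) :
    IsChainBetween β (stdFlag k) (chart β z) (braidProd β z • stdFlag k) := by
  induction β generalizing z with
  | nil => simp [isChainBetween_nil_iff, chart_nil, braidProd]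
  | cons i β ih =>
    obtain _ | ⟨z, zs⟩ := z
    · simp at hz
    rw [chart_cons, braidProd_cons, mul_smul]
    exact isChainBetween_cons_iff.mpr ⟨_, _, rfl, relPos_std_braidGL i z,
      (ih (by simpa using hz)).smul _⟩

theorem IsChainBetween.exists_chart {β : List (Fin (k - 1))} {F : CompleteFlag k}
    {Fs : List (CompleteFlag k)} (h : IsChainBetween β (stdFlag k) Fs F) :
    ∃ z : List ℂ, z.length = β.length ∧ chart β z = Fs := by
  induction β generalizing F Fs with
  | nil => exact ⟨[], rfl, by rw [chart_nil, (isChainBetween_nil_iff.mp h).1]⟩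
  | cons i β ih =>
    obtain ⟨P, Gs, rfl, hr, hc⟩ := isChainBetween_cons_iff.mp h
    obtain ⟨z, rfl⟩ := relPos_simple_std_iff.mp hr
    have hc' := hc.smul (braidGL i z)⁻¹
    rw [inv_smul_smul] at hc'
    obtain ⟨zs, hzs, hch⟩ := ih hc'
    exact ⟨z :: zs, by simp [hzs], by rw [chart_cons, hch, translate_translate_inv]⟩

theorem chart_injective {β : List (Fin (k - 1))} {z z' : List ℂ} (hz : z.length = β.length)
    (hz' : z'.length = β.length) (h : chart β z = chart β z') : z = z' := by
  induction β generalizing z z' with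
  | nil => simp_all
  | cons i β ih =>
    obtain _ | ⟨z, zs⟩ := z
    · simp at hz
    obtain _ | ⟨z', zs'⟩ := z'
    · simp at hz'
    rw [chart_cons, chart_cons, List.cons.injEq] at h
    have h2 := h.2
    replace hz : zs.length = β.length := by simpa using hz
    replace hz' : zs'.length = β.length := by simpa using hz'
    have hh := ((isChainBetween_chart hz).smul (braidGL i z)).head
    rw [h2, ((isChainBetween_chart hz').smul (braidGL i z')).head, Option.some.injEq] at hh
    obtain rfl := braidGL_smul_std_injective i hh
    rw [ih hz hz' (translate_injective _ h2)]

theorem chart_append {β γ : List (Fin (k - 1))} {z z' : List ℂ} (hz : z.length = β.length)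
    (hz' : z'.length = γ.length) :
    chart (β ++ γ) (z ++ z') =
      chart β z ++ (translate (braidProd β z) (chart γ z')).tail := by
  induction β generalizing z with
  | nil =>
    obtain rfl : z = [] := by simpa using hz
    have := (isChainBetween_chart hz').eq_cons
    simp only [List.nil_append, chart_nil, braidProd, List.zipWith_nil_left, List.prod_nil,
      translate_one, List.singleton_append]
    exact this
  | cons i β ih =>
    obtain _ | ⟨z, zs⟩ := z
    · simp at hz
    rw [List.cons_append, List.cons_append, chart_cons, ih (by simpa using hz), chart_cons,
      braidProd_cons, translate_append, translate_tail, translate_translate, List.cons_append]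

/-- The coordinates `z₂` belong to `B` pulled back by `B_{β₁}(z₁)`, so that it starts at the
standard flag. -/
theorem exists_coords_append {β₁ β₂ : List (Fin (k - 1))} {P Q : CompleteFlag k}
    {A B : List (CompleteFlag k)} (hA : IsChainBetween β₁ (stdFlag k) A P)
    (hB : IsChainBetween β₂ P B Q) :
    ∃ z₁ z₂ : List ℂ, z₁.length = β₁.length ∧ z₂.length = β₂.length ∧
      coords (β₁ ++ β₂) (A ++ B.tail) = z₁ ++ z₂ ∧ chart β₁ z₁ = A ∧
      translate (braidProd β₁ z₁) (chart β₂ z₂) = B ∧ P = braidProd β₁ z₁ • stdFlag k := by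
  obtain ⟨z₁, hz₁, rfl⟩ := hA.exists_chart
  have hP := (isChainBetween_chart hz₁).getLast
  rw [hA.getLast, Option.some.injEq] at hP
  subst hP
  have hB' := hB.smul (braidProd β₁ z₁)⁻¹
  rw [inv_smul_smul] at hB'
  obtain ⟨z₂, hz₂, hch⟩ := hB'.exists_chart
  have hch' : translate (braidProd β₁ z₁) (chart β₂ z₂) = B := by
    rw [hch, translate_translate_inv]
  refine ⟨z₁, z₂, hz₁, hz₂, ?_, rfl, hch', rfl⟩
  have hl : (z₁ ++ z₂).length = (β₁ ++ β₂).length := by simp [hz₁, hz₂]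
  have hc : chart (β₁ ++ β₂) (z₁ ++ z₂) = chart β₁ z₁ ++ B.tail := by
    rw [chart_append hz₁ hz₂, hch']
  exact theUnique_eq ⟨hl, hc⟩ fun z hz => chart_injective hz.1 hl (hz.2.trans hc.symm)

/-- On flags, sliding `U` through a word is just translation by `U`: the upper-triangular matrix
left over after each letter fixes the standard flag. -/
theorem slide_spec {β : List (Fin (k - 1))} {z : List ℂ} (hz : z.length = β.length)
    {U : GL (Fin k) ℂ} (hU : IsUpper U.val) :
    (slide U.val β z).length = β.length ∧
      chart β (slide U.val β z) = translate U (chart β z) := by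
  induction β generalizing z U with
  | nil =>
    obtain rfl : z = [] := by simpa using hz
    simp [slide, chart_nil, translate, smul_stdFlag_eq_iff.mpr hU]
  | cons i β ih =>
    obtain _ | ⟨z, zs⟩ := z
    · simp at hz
    have h := isUpper_smul_braidGL hU i z
    set z' := (U.val (lo i) (lo i) * z + U.val (lo i) (hi i)) / U.val (hi i) (hi i) with hz'
    have hV : IsUpper ((braidGL i z')⁻¹ * U * braidGL i z).val := by
      rw [← smul_stdFlag_eq_iff, mul_smul, mul_smul, h, inv_smul_smul]
    have hval : (braidMatrix i z')⁻¹ * U.val * braidMatrix i z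
        = ((braidGL i z')⁻¹ * U * braidGL i z).val := by
      rw [Units.val_mul, Units.val_mul, Matrix.coe_units_inv]
      rfl
    obtain ⟨h1, h2⟩ := ih (z := zs) (by simpa using hz) hV
    have hs : slide U.val (i :: β) (z :: zs)
        = z' :: slide ((braidGL i z')⁻¹ * U * braidGL i z).val β zs := by
      rw [← hval]; rfl
    rw [hs]
    refine ⟨by rw [List.length_cons, h1, List.length_cons], ?_⟩
    rw [chart_cons, h2, chart_cons, translate_translate, ← mul_assoc, ← mul_assoc,
      mul_inv_cancel, one_mul, ← translate_translate]
    change _ = (U • stdFlag k) :: translate U _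
    rw [smul_stdFlag_eq_iff.mpr hU]

/-! ### Triangular factors -/

theorem luFactors_mul {L U : GL (Fin k) ℂ} (hL : IsUnipotentLower L) (hU : IsUpper U.val) :
    luFactors (L * U).val = (L.val, U.val) := by
  refine theUnique_eq ⟨hL.1, hL.2, hU, rfl⟩ ?_
  rintro ⟨A, B⟩ ⟨hA, hA', hB, hAB⟩
  simp only at hA hA' hB hAB
  have hdet : IsUnit (A.det * B.det) := by
    rw [← Matrix.det_mul, ← hAB, ← Matrix.isUnit_iff_isUnit_det]
    exact (L * U).isUnit
  -- `luFactors` ranges over arbitrary matrices; competing factors are invertible because their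
  -- product is.
  lift A to GL (Fin k) ℂ using
    (Matrix.isUnit_iff_isUnit_det A).mpr (isUnit_of_mul_isUnit_left hdet)
  lift B to GL (Fin k) ℂ using
    (Matrix.isUnit_iff_isUnit_det B).mpr (isUnit_of_mul_isUnit_right hdet)
  have h : L * U = A * B := Units.ext hAB
  obtain rfl : A = L := IsUnipotentLower.eq_of_smul_std ⟨hA, hA'⟩ hL (by
    have := congrArg (· • stdFlag k) h
    simp only [mul_smul] at this
    rw [smul_stdFlag_eq_iff.mpr hB, smul_stdFlag_eq_iff.mpr hU] at this
    exact this.symm)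
  rw [mul_left_cancel h]

theorem lowerPart_smul_std {L : GL (Fin k) ℂ} (hL : IsUnipotentLower L) (w : Equiv.Perm (Fin k)) :
    lowerPart w (permGL (longest k * w * longest k) • L • stdFlag k) = L := by
  refine theUnique_eq ⟨hL.1, hL.2, 1, ?_, ?_⟩ ?_
  · rw [← smul_stdFlag_eq_iff, one_smul]
  · rw [ofMatrix_eq_smul, mul_one, mul_smul]
  · rintro L' ⟨h1, h2, U, hU, h3⟩
    rw [ofMatrix_eq_smul, mul_smul, mul_smul, smul_stdFlag_eq_iff.mpr hU] at h3
    exact (hL.eq_of_smul_std ⟨h1, h2⟩ (MulAction.injective _ h3)).symm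

theorem permGL_longest_conj_conj (g : GL (Fin k) ℂ) :
    permGL (longest k) * (permGL (longest k) * g * permGL (longest k)) * permGL (longest k) = g := by
  rw [mul_assoc, mul_assoc, mul_assoc, permGL_longest_mul_self, mul_one, ← mul_assoc,
    permGL_longest_mul_self, one_mul]

theorem upperPart_smul_std {L : GL (Fin k) ℂ} (hL : IsUnipotentLower L) :
    upperPart (L • stdFlag k) = permGL (longest k) * L * permGL (longest k) := by
  refine theUnique_eq ⟨isUpper_conj.mpr hL.1, isUnidiagonal_conj.mpr hL.2, 1, ?_, ?_⟩ ?_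
  · rw [← smul_stdFlag_eq_iff, one_smul]
  · rw [ofMatrix_eq_smul, mul_one, permGL_longest_conj_conj]
  · rintro V ⟨h1, h2, U, hU, h3⟩
    rw [ofMatrix_eq_smul, mul_smul, smul_stdFlag_eq_iff.mpr hU] at h3
    have hV := permGL_longest_conj_conj V
    rw [hL.eq_of_smul_std ⟨isUpper_conj.mp (by rwa [hV]),
      isUnidiagonal_conj.mp (by rwa [hV])⟩ h3, hV]

/-! ### Splicing of double Bott--Samelson varieties -/

/-- Here `U₁ = L⁻¹B_{β₁}(z₁)`. Sliding translates the chart of `z₂` by `U₁`, while `B` is its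
translate by `B_{β₁}(z₁)`; the difference is `L⁻¹`. -/
theorem bottSamelsonSplice_append {β₁ β₂ : List (Fin (k - 1))} {Q : CompleteFlag k}
    {A B : List (CompleteFlag k)} {L : GL (Fin k) ℂ} (hL : IsUnipotentLower L)
    (hA : IsChainBetween β₁ (stdFlag k) A (L • stdFlag k))
    (hB : IsChainBetween β₂ (L • stdFlag k) B Q) :
    bottSamelsonSplice β₁ β₂ (A ++ B.tail) = (A, translate L⁻¹ B) := by
  obtain ⟨z₁, z₂, hz₁, hz₂, hco, hc₁, hc₂, hP⟩ := exists_coords_append hA hB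
  have hU : IsUpper (L⁻¹ * braidProd β₁ z₁).val := by
    rw [← smul_stdFlag_eq_iff, mul_smul, ← hP, inv_smul_smul]
  have hlu := luFactors_mul hL hU
  rw [mul_inv_cancel_left] at hlu
  simp only [bottSamelsonSplice]
  rw [hco, List.take_left' hz₁, List.drop_left' hz₁, hlu, hc₁, (slide_spec hz₂ hU).2,
    ← translate_translate, hc₂]

theorem space_braidProd_append {β γ : List (Fin (k - 1))} {z z' : List ℂ}
    (hz : z.length = β.length) (hz' : z'.length = γ.length) {s : Fin (k - 1)} (hs : s ∉ γ) :
    (braidProd (β ++ γ) (z ++ z') • stdFlag k).space (lo s).succ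
      = (braidProd β z • stdFlag k).space (lo s).succ := by
  rw [braidProd_append hz, mul_smul]
  exact (((isChainBetween_chart hz').smul (braidProd β z)).space_eq hs).symm

theorem exists_last_occurrence {α : Type*} {s : α} {l : List α} (h : s ∈ l) :
    ∃ γ δ, l = γ ++ s :: δ ∧ s ∉ δ := by
  obtain ⟨as, bs, h1, h2⟩ := List.eq_append_cons_of_mem (List.mem_reverse.mpr h)
  exact ⟨bs.reverse, as.reverse, by simpa using congrArg List.reverse h1, by simpa using h2⟩

/-- The space of dimension `s + 1` is unchanged after the last letter `s`, so each minor tests that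
space of the final flag against the coordinate complement. -/
theorem transverse_iff_principalMinor {β : List (Fin (k - 1))} {z : List ℂ}
    (hz : z.length = β.length) :
    Transverse (braidProd β z • stdFlag k) (antFlag k) ↔
      ∀ (s : Fin (k - 1)) (γ δ : List (Fin (k - 1))), β = γ ++ s :: δ → s ∉ δ →
        principalMinor (s + 1) (by omega)
          (braidProd (γ ++ [s]) (z.take (γ.length + 1))).val ≠ 0 := by
  have hspace : ∀ (s : Fin (k - 1)) (γ δ : List (Fin (k - 1))), β = γ ++ s :: δ → s ∉ δ →
      (braidProd β z • stdFlag k).space (lo s).succ =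
        (braidProd (γ ++ [s]) (z.take (γ.length + 1)) • stdFlag k).space (lo s).succ := by
    rintro s γ δ rfl hs
    simp only [List.length_append, List.length_cons] at hz
    have := space_braidProd_append (β := γ ++ [s]) (γ := δ) (z := z.take (γ.length + 1))
      (z' := z.drop (γ.length + 1)) (by simp; omega) (by simp; omega) hs
    rwa [List.take_append_drop, List.append_assoc, List.singleton_append] at this
  constructor
  · intro h s γ δ hβ hs
    rw [principalMinor_ne_zero_iff]
    intro x hx
    change x ∈ (CompleteFlag.space _ (lo s).succ) at hx
    rw [← hspace s γ δ hβ hs] at hx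
    exact h.eq_zero_of_mem _ x hx
  · intro h
    refine transverse_antFlag_iff.mpr (exists_isUnipotentLower fun m x hx hx0 => ?_)
    rcases Nat.eq_zero_or_pos m with hm | hm
    · rw [CompleteFlag.space_zero _ hm] at hx
      exact hx
    rcases (Nat.lt_succ_iff.mp m.2).lt_or_eq with hm' | hm'
    · let s : Fin (k - 1) := ⟨m - 1, by omega⟩
      have hms : m = (lo s).succ := Fin.ext (by simp [lo, s]; omega)
      rw [hms] at hx hx0
      by_cases hs : s ∈ β
      · obtain ⟨γ, δ, hβ, hδ⟩ := exists_last_occurrence hs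
        rw [hspace s γ δ hβ hδ] at hx
        exact (principalMinor_ne_zero_iff _ _).mp (h s γ δ hβ hδ) x hx hx0
      · have := space_braidProd_append (β := []) (z := []) rfl hz hs
        rw [List.nil_append, List.nil_append] at this
        rw [this, braidProd, List.zipWith_nil_left, List.prod_nil, one_smul] at hx
        exact transverse_std_ant.eq_zero_of_mem _ x hx hx0
    · ext a
      exact hx0 a (by rw [hm']; exact a.2)

theorem mem_bottSamelson_iff {β : List (Fin (k - 1))} {Fs : List (CompleteFlag k)} :
    Fs ∈ bottSamelson β ↔
      ∃ Q, IsChainBetween β (stdFlag k) Fs Q ∧ Transverse Q (antFlag k) :=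
  ⟨fun ⟨h1, h2, Q, h3, h4⟩ => ⟨Q, ⟨h1, h2, h3⟩, h4⟩, fun ⟨Q, ⟨h1, h2, h3⟩, h4⟩ => ⟨h1, h2, Q, h3, h4⟩⟩

theorem mem_braidVariety_iff {β : List (Fin (k - 1))} {Fs : List (CompleteFlag k)} :
    Fs ∈ braidVariety β ↔ IsChainBetween β (stdFlag k) Fs (antFlag k) :=
  ⟨fun ⟨h1, h2, h3⟩ => ⟨h1, h2, h3⟩, fun ⟨h1, h2, h3⟩ => ⟨h1, h2, h3⟩⟩

theorem append_mem_bottSamelsonOpen_iff {β₁ β₂ : List (Fin (k - 1))} {P Q : CompleteFlag k}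
    {A B : List (CompleteFlag k)} (hA : IsChainBetween β₁ (stdFlag k) A P)
    (hB : IsChainBetween β₂ P B Q) (hQ : Transverse Q (antFlag k)) :
    A ++ B.tail ∈ bottSamelsonOpen β₁ β₂ ↔ Transverse P (antFlag k) := by
  obtain ⟨z₁, z₂, hz₁, hz₂, hco, hc₁, hc₂, rfl⟩ := exists_coords_append hA hB
  have hmem : A ++ B.tail ∈ bottSamelson (β₁ ++ β₂) :=
    mem_bottSamelson_iff.mpr ⟨Q, hA.append hB, hQ⟩
  rw [transverse_iff_principalMinor hz₁, bottSamelsonOpen, Set.mem_ofPred_eq, and_iff_right hmem,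
    hco]
  refine forall₅_congr fun s γ δ hβ _ => ?_
  rw [List.take_append_of_le_length (by rw [hz₁, hβ]; simp)]

/-! ### The maps `φ₁` and `φ₂` on chains -/

/-- The junction flag is shared, so it may be omitted from either side; `phi₂` omits it on the left,
concatenation of chains on the right. -/
theorem IsChainBetween.dropLast_append {β γ : List (Fin (k - 1))} {F F' F'' : CompleteFlag k}
    {Fs Gs : List (CompleteFlag k)} (h : IsChainBetween β F Fs F')
    (h' : IsChainBetween γ F' Gs F'') : Fs.dropLast ++ Gs = Fs ++ Gs.tail := by
  obtain ⟨ys, rfl⟩ := List.getLast?_eq_some_iff.mp h.getLast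
  rw [List.dropLast_concat, List.append_assoc, List.singleton_append, ← h'.eq_cons]

theorem IsChainBetween.take_append {β : List (Fin (k - 1))} {F F' : CompleteFlag k}
    {Fs : List (CompleteFlag k)} (h : IsChainBetween β F Fs F') (Gs : List (CompleteFlag k)) :
    (Fs ++ Gs).take (β.length + 1) = Fs := List.take_left' h.length

theorem IsChainBetween.drop_append {β γ : List (Fin (k - 1))} {F F' F'' : CompleteFlag k}
    {Fs Gs : List (CompleteFlag k)} (h : IsChainBetween β F Fs F')
    (h' : IsChainBetween γ F' Gs F'') : (Fs ++ Gs.tail).drop β.length = Gs := by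
  rw [← h.dropLast_append h']
  exact List.drop_left' (by rw [List.length_dropLast, h.length]; rfl)

theorem IsChainBetween.getElem?_append {β : List (Fin (k - 1))} {F F' : CompleteFlag k}
    {Fs : List (CompleteFlag k)} (h : IsChainBetween β F Fs F') (Gs : List (CompleteFlag k)) :
    (Fs ++ Gs)[β.length]? = some F' := by
  rw [List.getElem?_append_left (by rw [h.length]; omega)]
  have := h.getLast
  rwa [List.getLast?_eq_getElem?, h.length] at this

theorem IsChainBetween.eq_of_getLast {β γ : List (Fin (k - 1))} {F F' G G' : CompleteFlag k}
    {Fs : List (CompleteFlag k)} (h : IsChainBetween β F Fs F') (h' : IsChainBetween γ G Fs G') :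
    F' = G' := Option.some.inj (h.getLast.symm.trans h'.getLast)

theorem IsChainBetween.phi₁_eq {β : List (Fin (k - 1))} {F Q : CompleteFlag k}
    {Fs : List (CompleteFlag k)} (h : IsChainBetween β F Fs Q) (Δ : List (Fin (k - 1))) :
    phi₁ Δ Fs = Fs ++ (path Δ Q (antFlag k)).tail := by
  rw [phi₁, List.getLastD_eq_getLast?, h.getLast]; rfl

theorem smul_ant_eq_of_isUnipotentLower {L : GL (Fin k) ℂ} (hL : IsUnipotentLower L) :
    (permGL (longest k) * L⁻¹) • antFlag k = stdFlag k := by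
  rw [mul_smul, hL.inv_smul_ant, permGL_longest_smul_ant]

theorem smul_smul_std_eq (L : GL (Fin k) ℂ) :
    (permGL (longest k) * L⁻¹) • L • stdFlag k = antFlag k := by
  rw [mul_smul, inv_smul_smul, permGL_longest_smul_std]

theorem transverse_std_smul_std {L : GL (Fin k) ℂ} (hL : IsUnipotentLower L) :
    Transverse (stdFlag k) ((permGL (longest k) * L⁻¹) • stdFlag k) := by
  have := (Transverse.symm transverse_std_ant).smul (permGL (longest k) * L⁻¹)
  rwa [smul_ant_eq_of_isUnipotentLower hL] at this

variable {Δ : List (Fin (k - 1))}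

theorem isChainBetween_path_std (hΔ : IsReducedWord (longest k) Δ) {L : GL (Fin k) ℂ}
    (hL : IsUnipotentLower L) :
    IsChainBetween Δ (stdFlag k)
      (path Δ (stdFlag k) ((permGL (longest k) * L⁻¹) • stdFlag k))
      ((permGL (longest k) * L⁻¹) • stdFlag k) :=
  RelPos.isChainBetween_path hΔ (transverse_std_smul_std hL)

/-- With `V₁ = w₀Lw₀`, the translating matrix `V₁⁻¹w₀` simplifies to `w₀L⁻¹`. -/
theorem IsChainBetween.phi₂_eq (hΔ : IsReducedWord (longest k) Δ) {β : List (Fin (k - 1))}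
    {Fs : List (CompleteFlag k)} {L : GL (Fin k) ℂ} (hL : IsUnipotentLower L)
    (h : IsChainBetween β (stdFlag k) Fs (L • stdFlag k)) :
    phi₂ Δ Fs = path Δ (stdFlag k) ((permGL (longest k) * L⁻¹) • stdFlag k) ++
      (translate (permGL (longest k) * L⁻¹) Fs).tail := by
  have hg : (permGL (longest k) * L * permGL (longest k))⁻¹ * permGL (longest k)
      = permGL (longest k) * L⁻¹ := by
    rw [mul_inv_rev, mul_inv_rev, permGL_longest_inv, mul_assoc, mul_assoc,
      permGL_longest_mul_self, mul_one]
  simp only [phi₂]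
  rw [List.getLastD_eq_getLast?, h.getLast, List.headD_eq_head?_getD, h.head, Option.getD_some,
    Option.getD_some, upperPart_smul_std hL, hg]
  exact (isChainBetween_path_std hΔ hL).dropLast_append (h.smul _)

theorem translate_path (hΔ : IsReducedWord (longest k) Δ) {F F' : CompleteFlag k}
    (h : Transverse F F') (g : GL (Fin k) ℂ) :
    translate g (path Δ F F') = path Δ (g • F) (g • F') :=
  (((RelPos.isChainBetween_path hΔ h).smul g).eq_path hΔ).symm

theorem bijOn_phi₁ (hΔ : IsReducedWord (longest k) Δ) (β : List (Fin (k - 1))) :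
    Set.BijOn (phi₁ Δ) (bottSamelson β) (braidVariety (β ++ Δ)) := by
  refine ⟨?_, ?_, ?_⟩
  · intro Fs hFs
    obtain ⟨Q, hc, hQ⟩ := mem_bottSamelson_iff.mp hFs
    rw [hc.phi₁_eq]
    exact mem_braidVariety_iff.mpr (hc.append (RelPos.isChainBetween_path hΔ hQ))
  · intro Fs hFs Gs hGs h
    obtain ⟨Q, hc, -⟩ := mem_bottSamelson_iff.mp hFs
    obtain ⟨Q', hc', -⟩ := mem_bottSamelson_iff.mp hGs
    rw [hc.phi₁_eq, hc'.phi₁_eq] at h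
    exact List.append_inj_left h (by rw [hc.length, hc'.length])
  · intro Hs hHs
    obtain ⟨Q, Fs, Gs, rfl, hF, hG⟩ := (mem_braidVariety_iff.mp hHs).exists_append
    refine ⟨Fs, mem_bottSamelson_iff.mpr ⟨Q, hF, hG.relPos hΔ⟩, ?_⟩
    rw [hF.phi₁_eq, hG.eq_path hΔ]

theorem bijOn_phi₂ (hΔ : IsReducedWord (longest k) Δ) (β : List (Fin (k - 1))) :
    Set.BijOn (phi₂ Δ) (bottSamelson β) (braidVariety (Δ ++ β)) := by
  refine ⟨?_, ?_, ?_⟩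
  · intro Fs hFs
    obtain ⟨Q, hc, hQ⟩ := mem_bottSamelson_iff.mp hFs
    obtain ⟨L, hL, rfl⟩ := transverse_antFlag_iff.mp hQ
    rw [hc.phi₂_eq hΔ hL]
    have h := hc.smul (permGL (longest k) * L⁻¹)
    rw [smul_smul_std_eq] at h
    exact mem_braidVariety_iff.mpr ((isChainBetween_path_std hΔ hL).append h)
  · intro Fs hFs Gs hGs h
    obtain ⟨Q, hc, hQ⟩ := mem_bottSamelson_iff.mp hFs
    obtain ⟨L, hL, rfl⟩ := transverse_antFlag_iff.mp hQ
    obtain ⟨Q', hc', hQ'⟩ := mem_bottSamelson_iff.mp hGs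
    obtain ⟨L', hL', rfl⟩ := transverse_antFlag_iff.mp hQ'
    rw [hc.phi₂_eq hΔ hL, hc'.phi₂_eq hΔ hL'] at h
    have hp := isChainBetween_path_std hΔ hL
    have hp' := isChainBetween_path_std hΔ hL'
    -- The two `Δ`-prefixes coincide, hence so do their last flags `w₀L⁻¹ • stdFlag k` and `w₀L'⁻¹ •
    -- stdFlag k`; this gives `L = L'`.
    obtain ⟨h1, h2⟩ := List.append_inj h (by rw [hp.length, hp'.length])
    rw [← h1] at hp'
    have h3 := hp.eq_of_getLast hp'
    rw [mul_smul, mul_smul] at h3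
    have h4 := hL.inv.eq_of_smul_std hL'.inv (MulAction.injective _ h3)
    rw [inv_inj] at h4
    subst h4
    rw [← translate_tail, ← translate_tail] at h2
    rw [hc.eq_cons, hc'.eq_cons, translate_injective _ h2]
  · intro Hs hHs
    obtain ⟨R, Fs, Gs, rfl, hF, hG⟩ := (mem_braidVariety_iff.mp hHs).exists_append
    -- The junction `R` must be `w₀L⁻¹ • stdFlag k`. Since `w₀R` is transverse to `antFlag`, it is
    -- `M • stdFlag k`, and the required `L` is `M⁻¹`.
    have hR := (Transverse.symm (hF.relPos hΔ)).smul (permGL (longest k))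
    rw [permGL_longest_smul_std] at hR
    obtain ⟨M, hM, hMR⟩ := transverse_antFlag_iff.mp hR
    have hgR : (permGL (longest k) * M⁻¹⁻¹) • stdFlag k = R := by
      rw [inv_inv, mul_smul, ← hMR, permGL_longest_smul_smul]
    have hc := hG.smul (permGL (longest k) * M⁻¹⁻¹)⁻¹
    rw [inv_smul_eq_iff.mpr hgR.symm, inv_smul_eq_iff.mpr (smul_smul_std_eq M⁻¹).symm] at hc
    refine ⟨_, mem_bottSamelson_iff.mpr ⟨_, hc, hM.inv.transverse⟩, ?_⟩
    rw [hc.phi₂_eq hΔ hM.inv, translate_translate_inv, hgR, hF.eq_path hΔ]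

/-! ### The open sets -/

/-- A bijection restricts to subsets that correspond under it. -/
theorem BijOn.restrict_of_mem_iff {α β : Type*} {f : α → β} {S S' : Set α} {T T' : Set β}
    (h : Set.BijOn f S T) (hS : S' ⊆ S) (hT : T' ⊆ T) (hiff : ∀ x ∈ S, x ∈ S' ↔ f x ∈ T') :
    Set.BijOn f S' T' := by
  refine ⟨fun x hx => (hiff x (hS hx)).mp hx, h.injOn.mono hS, fun y hy => ?_⟩
  obtain ⟨x, hx, rfl⟩ := h.surjOn (hT hy)
  exact ⟨x, (hiff x hx).mpr hy, rfl⟩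

theorem exists_decomposition {β₁ β₂ : List (Fin (k - 1))} {Fs : List (CompleteFlag k)}
    (h : Fs ∈ bottSamelson (β₁ ++ β₂)) :
    ∃ P A B, ∃ M : GL (Fin k) ℂ, Fs = A ++ B.tail ∧ IsUnipotentLower M ∧
      IsChainBetween β₁ (stdFlag k) A P ∧ IsChainBetween β₂ P B (M • stdFlag k) := by
  obtain ⟨Q, hc, hQ⟩ := mem_bottSamelson_iff.mp h
  obtain ⟨M, hM, rfl⟩ := transverse_antFlag_iff.mp hQ
  obtain ⟨P, A, B, rfl, hA, hB⟩ := hc.exists_append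
  exact ⟨P, A, B, M, rfl, hM, hA, hB⟩

theorem exists_open_decomposition {β₁ β₂ : List (Fin (k - 1))} {Fs : List (CompleteFlag k)}
    (h : Fs ∈ bottSamelsonOpen β₁ β₂) :
    ∃ A B, ∃ L M : GL (Fin k) ℂ, Fs = A ++ B.tail ∧ IsUnipotentLower L ∧ IsUnipotentLower M ∧
      IsChainBetween β₁ (stdFlag k) A (L • stdFlag k) ∧
      IsChainBetween β₂ (L • stdFlag k) B (M • stdFlag k) := by
  obtain ⟨P, A, B, M, rfl, hM, hA, hB⟩ := exists_decomposition h.1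
  rw [append_mem_bottSamelsonOpen_iff hA hB hM.transverse] at h
  obtain ⟨L, hL, rfl⟩ := transverse_antFlag_iff.mp h
  exact ⟨A, B, L, M, rfl, hL, hM, hA, hB⟩

theorem append_mem_braidOpen_iff {β : List (Fin (k - 1))} {r : ℕ} {w : Equiv.Perm (Fin k)}
    {γ : List (Fin (k - 1))} {F P : CompleteFlag k} {A C : List (CompleteFlag k)}
    (hA : IsChainBetween γ F A P) (hr : r = γ.length) (h : A ++ C ∈ braidVariety β) :
    A ++ C ∈ braidOpen r w β ↔ Transverse P (coordFlag (longest k * w)) := by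
  subst hr
  simp [braidOpen, h, hA.getElem?_append]

theorem bijOn_phi₁_open (hΔ : IsReducedWord (longest k) Δ) (β₁ β₂ : List (Fin (k - 1))) :
    Set.BijOn (phi₁ Δ) (bottSamelsonOpen β₁ β₂) (braidOpen β₁.length 1 ((β₁ ++ β₂) ++ Δ)) := by
  refine BijOn.restrict_of_mem_iff (bijOn_phi₁ hΔ (β₁ ++ β₂)) (fun _ h => h.1) (fun _ h => h.1) ?_
  intro Fs hFs
  have hmem := (bijOn_phi₁ hΔ (β₁ ++ β₂)).mapsTo hFs
  obtain ⟨P, A, B, M, rfl, hM, hA, hB⟩ := exists_decomposition hFs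
  rw [append_mem_bottSamelsonOpen_iff hA hB hM.transverse]
  rw [(hA.append hB).phi₁_eq, List.append_assoc A] at hmem ⊢
  rw [append_mem_braidOpen_iff hA rfl hmem, mul_one, antFlag]

theorem phi₂_append (hΔ : IsReducedWord (longest k) Δ) {β₁ β₂ : List (Fin (k - 1))}
    {P : CompleteFlag k} {A B : List (CompleteFlag k)} {M : GL (Fin k) ℂ}
    (hM : IsUnipotentLower M) (hA : IsChainBetween β₁ (stdFlag k) A P)
    (hB : IsChainBetween β₂ P B (M • stdFlag k)) :
    phi₂ Δ (A ++ B.tail) =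
      (path Δ (stdFlag k) ((permGL (longest k) * M⁻¹) • stdFlag k) ++
        (translate (permGL (longest k) * M⁻¹) A).tail) ++
      (translate (permGL (longest k) * M⁻¹) B).tail := by
  rw [(hA.append hB).phi₂_eq hΔ hM, translate_append, translate_tail, List.append_assoc,
    List.tail_append_of_ne_nil]
  rw [hA.eq_cons]
  simp [translate]

theorem bijOn_phi₂_open (hΔ : IsReducedWord (longest k) Δ) (β₁ β₂ : List (Fin (k - 1))) :
    Set.BijOn (phi₂ Δ) (bottSamelsonOpen β₁ β₂)
      (braidOpen (β₁.length + Δ.length) (longest k) (Δ ++ (β₁ ++ β₂))) := by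
  refine BijOn.restrict_of_mem_iff (bijOn_phi₂ hΔ (β₁ ++ β₂)) (fun _ h => h.1) (fun _ h => h.1) ?_
  intro Fs hFs
  have hmem := (bijOn_phi₂ hΔ (β₁ ++ β₂)).mapsTo hFs
  obtain ⟨P, A, B, M, rfl, hM, hA, hB⟩ := exists_decomposition hFs
  rw [append_mem_bottSamelsonOpen_iff hA hB hM.transverse]
  rw [phi₂_append hΔ hM hA hB] at hmem ⊢
  -- The test flag `𝓕(w₀w₀)` is the standard one, which is the image of `antFlag` under the
  -- translation `w₀M⁻¹` used by `phi₂`.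
  rw [append_mem_braidOpen_iff ((isChainBetween_path_std hΔ hM).append (hA.smul _))
    (by simp [add_comm]) hmem, longest_mul_longest, ← stdFlag,
    ← smul_ant_eq_of_isUnipotentLower hM]
  exact relPos_smul_iff.symm

theorem mapsTo_bottSamelsonSplice (β₁ β₂ : List (Fin (k - 1))) :
    Set.MapsTo (bottSamelsonSplice β₁ β₂) (bottSamelsonOpen β₁ β₂)
      (bottSamelson β₁ ×ˢ bottSamelson β₂) := by
  intro Fs hFs
  obtain ⟨A, B, L, M, rfl, hL, hM, hA, hB⟩ := exists_open_decomposition hFs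
  rw [bottSamelsonSplice_append hL hA hB]
  refine ⟨mem_bottSamelson_iff.mpr ⟨_, hA, hL.transverse⟩, mem_bottSamelson_iff.mpr ⟨_, ?_,
    (hL.inv.mul hM).transverse⟩⟩
  have := hB.smul L⁻¹
  rwa [inv_smul_smul, smul_smul] at this

/-! ### Compatibility of the splicing maps -/

theorem prodMap_bottSamelsonSplice (hΔ : IsReducedWord (longest k) Δ)
    {β₁ β₂ : List (Fin (k - 1))} {A B : List (CompleteFlag k)} {L M : GL (Fin k) ℂ}
    (hL : IsUnipotentLower L) (hA : IsChainBetween β₁ (stdFlag k) A (L • stdFlag k))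
    (hB : IsChainBetween β₂ (L • stdFlag k) B (M • stdFlag k)) :
    Prod.map (phi₂ Δ) (phi₁ Δ) (bottSamelsonSplice β₁ β₂ (A ++ B.tail)) =
      (path Δ (stdFlag k) ((permGL (longest k) * L⁻¹) • stdFlag k) ++
        (translate (permGL (longest k) * L⁻¹) A).tail,
       translate L⁻¹ B ++ (path Δ (L⁻¹ • M • stdFlag k) (antFlag k)).tail) := by
  rw [bottSamelsonSplice_append hL hA hB, Prod.map_apply, hA.phi₂_eq hΔ hL,
    (hB.smul L⁻¹).phi₁_eq]

/-- For `w = e` the matrices are `g₂ = L⁻¹` and `g₁ = w₀L⁻¹`. The first fixes `antFlag`, so it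
carries the appended path to the one `phi₁` needs; the second turns the path from `antFlag` to
`stdFlag` into the prefix of `phi₂`. -/
theorem braidSplice_phi₁ (hΔ : IsReducedWord (longest k) Δ)
    {β₁ β₂ : List (Fin (k - 1))} {A B : List (CompleteFlag k)} {L M : GL (Fin k) ℂ}
    (hL : IsUnipotentLower L) (hM : IsUnipotentLower M)
    (hA : IsChainBetween β₁ (stdFlag k) A (L • stdFlag k))
    (hB : IsChainBetween β₂ (L • stdFlag k) B (M • stdFlag k)) :
    braidSplice β₁.length 1 [] Δ (phi₁ Δ (A ++ B.tail)) =
      (path Δ (stdFlag k) ((permGL (longest k) * L⁻¹) • stdFlag k) ++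
        (translate (permGL (longest k) * L⁻¹) A).tail,
       translate L⁻¹ B ++ (path Δ (L⁻¹ • M • stdFlag k) (antFlag k)).tail) := by
  have hD := RelPos.isChainBetween_path hΔ hM.transverse
  have hone : permGL (longest k * 1 * longest k) = 1 := by
    rw [mul_one, longest_mul_longest, permGL_one]
  have hlow : lowerPart 1 (L • stdFlag k) = L := by
    have := lowerPart_smul_std hL 1
    rwa [hone, one_smul] at this
  have hBD := hB.append hD
  have htail : B.tail ++ (path Δ (M • stdFlag k) (antFlag k)).tail
      = (B ++ (path Δ (M • stdFlag k) (antFlag k)).tail).tail := by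
    rw [List.tail_append_of_ne_nil]
    rw [hB.eq_cons]; simp
  simp only [braidSplice]
  rw [(hA.append hB).phi₁_eq, List.append_assoc, htail, List.getD_eq_getElem?_getD,
    hA.getElem?_append, Option.getD_some, hlow, hone, one_mul, hA.take_append,
    hA.drop_append hBD]
  have hpath := (Transverse.symm transverse_std_ant : Transverse (antFlag k) (stdFlag k))
  congr 1
  · rw [List.length_nil, List.drop_zero, List.nil_append, translate_append, translate_tail,
      translate_path hΔ hpath, smul_ant_eq_of_isUnipotentLower hL]
  · have hbot := (RelPos.isChainBetween_path hΔ hpath).eq_cons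
    rw [List.length_nil, List.nil_append, hbot, List.take_succ_cons, List.take_zero,
      List.tail_cons, List.append_nil, translate_append, translate_tail,
      translate_path hΔ hM.transverse, hL.inv_smul_ant]

/-- The spliced flag is `w₀M⁻¹L • stdFlag k`, so `g₂ = (w₀M⁻¹L)⁻¹`. Applied after the translation by
`w₀M⁻¹` it leaves `L⁻¹` (`hg`), and all trace of `M` disappears from the first component. -/
theorem braidSplice_phi₂ (hΔ : IsReducedWord (longest k) Δ)
    {β₁ β₂ : List (Fin (k - 1))} {A B : List (CompleteFlag k)} {L M : GL (Fin k) ℂ}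
    (hL : IsUnipotentLower L) (hM : IsUnipotentLower M)
    (hA : IsChainBetween β₁ (stdFlag k) A (L • stdFlag k))
    (hB : IsChainBetween β₂ (L • stdFlag k) B (M • stdFlag k)) :
    braidSplice (β₁.length + Δ.length) (longest k) Δ [] (phi₂ Δ (A ++ B.tail)) =
      (path Δ (stdFlag k) ((permGL (longest k) * L⁻¹) • stdFlag k) ++
        (translate (permGL (longest k) * L⁻¹) A).tail,
       translate L⁻¹ B ++ (path Δ (L⁻¹ • M • stdFlag k) (antFlag k)).tail) := by
  have hX := isChainBetween_path_std hΔ hM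
  have hY := hX.append (hA.smul (permGL (longest k) * M⁻¹))
  have hZ := hB.smul (permGL (longest k) * M⁻¹)
  rw [smul_smul_std_eq] at hZ
  have hN : IsUnipotentLower (M⁻¹ * L) := hM.inv.mul hL
  have hperm : longest k * longest k * longest k = longest k := by
    rw [longest_mul_longest, one_mul]
  have hlow : lowerPart (longest k) ((permGL (longest k) * M⁻¹) • L • stdFlag k) = M⁻¹ * L := by
    have := lowerPart_smul_std hN (longest k)
    rwa [hperm, smul_smul, ← mul_assoc, ← smul_smul] at this
  have hlen : β₁.length + Δ.length = (Δ ++ β₁).length := by simp [add_comm]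
  have hg : (permGL (longest k) * (M⁻¹ * L))⁻¹ * (permGL (longest k) * M⁻¹) = L⁻¹ := by group
  have hpath := (Transverse.symm transverse_std_ant : Transverse (antFlag k) (stdFlag k))
  have hbot := RelPos.isChainBetween_path hΔ hpath
  have hg₂ant : (permGL (longest k) * (M⁻¹ * L))⁻¹ • antFlag k = L⁻¹ • M • stdFlag k := by
    rw [← smul_smul_std_eq M, smul_smul _ _ (M • stdFlag k), hg]
  have hg₂std : (permGL (longest k) * (M⁻¹ * L))⁻¹ • stdFlag k = antFlag k := by
    rw [inv_smul_eq_iff, mul_smul, hN.smul_ant, permGL_longest_smul_ant]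
  simp only [braidSplice]
  rw [phi₂_append hΔ hM hA hB, hlen, List.getD_eq_getElem?_getD, hY.getElem?_append,
    Option.getD_some, hperm, hlow, hY.take_append, hY.drop_append hZ, List.append_nil]
  congr 1
  -- For `w = w₀` the whole of `Δ` is the prefix, so only the final flag survives. It replaces the
  -- starting flag removed by `tail`.
  · have hdrop : (path Δ (antFlag k) (stdFlag k)).drop Δ.length = [stdFlag k] := by
      have := hbot.drop_append (isChainBetween_nil_iff.mpr ⟨rfl, rfl⟩)
      rwa [List.tail_cons, List.append_nil] at this
    rw [hdrop, List.singleton_append, ← hY.eq_cons, translate_append, translate_tail,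
      translate_translate, mul_assoc, hg, translate_path hΔ (transverse_std_smul_std hM),
      mul_smul, hg₂std, permGL_longest_smul_ant, smul_smul, mul_assoc, hg]
  · have htake : (path Δ (antFlag k) (stdFlag k)).take (Δ.length + 1)
        = path Δ (antFlag k) (stdFlag k) := List.take_of_length_le hbot.length.le
    rw [htake, translate_append, translate_translate, hg, translate_tail,
      translate_path hΔ hpath, hg₂ant, hg₂std]

end Splicing

theorem theorem1p7 (k : ℕ) (Δ : List (Fin (k - 1))) (hΔ : IsReducedWord (longest k) Δ)
    (β₁ β₂ : List (Fin (k - 1))) :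
    -- `φ₁` and `φ₂` are well-defined bijections for every braid word `β`
    (∀ β : List (Fin (k - 1)),
      Set.BijOn (phi₁ Δ) (bottSamelson β) (braidVariety (β ++ Δ)) ∧
      Set.BijOn (phi₂ Δ) (bottSamelson β) (braidVariety (Δ ++ β))) ∧
    -- the top arrow of both squares
    Set.MapsTo (bottSamelsonSplice β₁ β₂) (bottSamelsonOpen β₁ β₂)
      (bottSamelson β₁ ×ˢ bottSamelson β₂) ∧
    -- the first square: `w = e`
    (Set.BijOn (phi₁ Δ) (bottSamelsonOpen β₁ β₂)
        (braidOpen β₁.length 1 ((β₁ ++ β₂) ++ Δ)) ∧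
      Set.MapsTo (braidSplice β₁.length 1 [] Δ) (braidOpen β₁.length 1 ((β₁ ++ β₂) ++ Δ))
        (braidVariety (Δ ++ β₁) ×ˢ braidVariety (β₂ ++ Δ)) ∧
      ∀ Fs ∈ bottSamelsonOpen β₁ β₂,
        Prod.map (phi₂ Δ) (phi₁ Δ) (bottSamelsonSplice β₁ β₂ Fs) =
          braidSplice β₁.length 1 [] Δ (phi₁ Δ Fs)) ∧
    -- the second square: `w = w₀`
    (Set.BijOn (phi₂ Δ) (bottSamelsonOpen β₁ β₂)
        (braidOpen (β₁.length + Δ.length) (longest k) (Δ ++ (β₁ ++ β₂))) ∧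
      Set.MapsTo (braidSplice (β₁.length + Δ.length) (longest k) Δ [])
        (braidOpen (β₁.length + Δ.length) (longest k) (Δ ++ (β₁ ++ β₂)))
        (braidVariety (Δ ++ β₁) ×ˢ braidVariety (β₂ ++ Δ)) ∧
      ∀ Fs ∈ bottSamelsonOpen β₁ β₂,
        Prod.map (phi₂ Δ) (phi₁ Δ) (bottSamelsonSplice β₁ β₂ Fs) =
          braidSplice (β₁.length + Δ.length) (longest k) Δ [] (phi₂ Δ Fs)) := by
  have hsplice := mapsTo_bottSamelsonSplice β₁ β₂
  have hprod : ∀ Fs ∈ bottSamelsonOpen β₁ β₂,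
      Prod.map (phi₂ Δ) (phi₁ Δ) (bottSamelsonSplice β₁ β₂ Fs) ∈
        braidVariety (Δ ++ β₁) ×ˢ braidVariety (β₂ ++ Δ) := fun Fs hFs =>
    ⟨(bijOn_phi₂ hΔ β₁).mapsTo (hsplice hFs).1, (bijOn_phi₁ hΔ β₂).mapsTo (hsplice hFs).2⟩
  have hsq₁ : ∀ Fs ∈ bottSamelsonOpen β₁ β₂,
      Prod.map (phi₂ Δ) (phi₁ Δ) (bottSamelsonSplice β₁ β₂ Fs) =
        braidSplice β₁.length 1 [] Δ (phi₁ Δ Fs) := by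
    intro Fs hFs
    obtain ⟨A, B, L, M, rfl, hL, hM, hA, hB⟩ := exists_open_decomposition hFs
    rw [prodMap_bottSamelsonSplice hΔ hL hA hB, braidSplice_phi₁ hΔ hL hM hA hB]
  have hsq₂ : ∀ Fs ∈ bottSamelsonOpen β₁ β₂,
      Prod.map (phi₂ Δ) (phi₁ Δ) (bottSamelsonSplice β₁ β₂ Fs) =
        braidSplice (β₁.length + Δ.length) (longest k) Δ [] (phi₂ Δ Fs) := by
    intro Fs hFs
    obtain ⟨A, B, L, M, rfl, hL, hM, hA, hB⟩ := exists_open_decomposition hFs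
    rw [prodMap_bottSamelsonSplice hΔ hL hA hB, braidSplice_phi₂ hΔ hL hM hA hB]
  refine ⟨fun β => ⟨bijOn_phi₁ hΔ β, bijOn_phi₂ hΔ β⟩, hsplice,
    ⟨bijOn_phi₁_open hΔ β₁ β₂, ?_, hsq₁⟩, ⟨bijOn_phi₂_open hΔ β₁ β₂, ?_, hsq₂⟩⟩
  · intro Hs hHs
    -- Every point of the open set comes from `phi₁`, so the commuting square gives the target of
    -- the splicing map.
    obtain ⟨Fs, hFs, rfl⟩ := (bijOn_phi₁_open hΔ β₁ β₂).surjOn hHs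
    rw [← hsq₁ Fs hFs]
    exact hprod Fs hFs
  · intro Hs hHs
    obtain ⟨Fs, hFs, rfl⟩ := (bijOn_phi₂_open hΔ β₁ β₂).surjOn hHs
    rw [← hsq₂ Fs hFs]
    exact hprod Fs hFs
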